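/- Let $A$ be a quantum system of finite dimension $d$ and let $(\Lambda_t)_{t\ge 0}$ be a quantum evolution of $A$, i.e. a family of completely positive trace-preserving (CPTP) linear maps on the complex $d\times d$ matrices with $\Lambda_0=\mathrm{id}$, continuous in $t$ on $[0,\infty)$ and differentiable in $t$ on $(0,\infty)$. Suppose that the evolution is non-Markovian, i.e. not CP-divisible: it is not true that for all $0\le s\le t$ there is a CPTP map $V_{t,s}$ with $\Lambda_t=V_{t,s}\circ\Lambda_s$. Suppose moreover that the evolution is invertible (for every $t\ge 0$ there is a linear map $\Lambda_t^{-1}$, not necessarily positive, with $\Lambda_t^{-1}\circ\Lambda_t=\mathrm{id}$) or that $A$ is a single qubit ($d=2$, in which case $\Lambda_t$ need not be invertible). Then there exist finite-dimensional ancillary systems $B$, $C$ and a quantum state $\rho^{ABC}$ such that, for some $t>0$, the derivative below exists and $$\frac{\mathrm{d}}{\mathrm{d}t}\,E^{AB|C}\!\left(\Lambda_t^{A}\otimes \mathrm{id}^{BC}\left[\rho^{ABC}\right]\right)>0 ,$$ where $E^{AB|C}(\rho)=\frac{\|\rho^{T_C}\|_1-1}{2}$ is the negativity in the bipartition $AB|C$,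 $T_C$ is the partial transposition on $C$, and $\|M\|_1=\mathrm{Tr}\sqrt{M^\dagger M}$. -/

import Mathlib

open scoped ComplexOrder MatrixOrder Matrix.Norms.L2Operator

noncomputable section

/-- The complex `n × n` matrices, i.e. the operators on a finite-dimensional Hilbert space with
orthonormal basis indexed by `n`; composite systems are indexed by product types. -/
abbrev Op (n : Type) : Type := Matrix n n ℂ

/-- A quantum state (density matrix): positive semidefinite with unit trace. -/
def IsState {n : Type} [Fintype n] (ρ : Op n) : Prop :=
  ρ.PosSemidef ∧ ρ.trace = 1

/-- The map `Φ ⊗ id` acting on operators of the system `n` together with an ancilla `β`: `Φ` is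
applied to each of the blocks indexed by a pair of ancilla indices. -/
def ampliation {n : Type} (β : Type) (Φ : Op n →ₗ[ℂ] Op n) (X : Op (n × β)) : Op (n × β) :=
  Matrix.of fun p q => Φ (Matrix.of fun i j => X (i, p.2) (j, q.2)) p.1 q.1

/-- Complete positivity: `Φ ⊗ id` preserves positive semidefiniteness for every finite-dimensional
ancilla. -/
def IsCompletelyPositive {n : Type} [Fintype n] (Φ : Op n →ₗ[ℂ] Op n) : Prop :=
  ∀ (k : ℕ) (X : Op (n × Fin k)), X.PosSemidef → (ampliation (Fin k) Φ X).PosSemidef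

/-- Completely positive trace-preserving maps (quantum operations). -/
structure IsCPTP {n : Type} [Fintype n] (Φ : Op n →ₗ[ℂ] Op n) : Prop where
  completelyPositive : IsCompletelyPositive Φ
  trace_map : ∀ X : Op n, (Φ X).trace = X.trace

/-- The trace norm `‖M‖₁ = Tr √(M† M)`. -/
def traceNorm {n : Type} [Fintype n] [DecidableEq n] (M : Op n) : ℝ :=
  (CFC.sqrt (M.conjTranspose * M)).trace.re

/-- Partial transposition with respect to the second tensor factor. -/
def partialTranspose {α β : Type} (X : Op (α × β)) : Op (α × β) :=
  Matrix.of fun p q => X (p.1, q.2) (q.1, p.2)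

/-- The negativity `(‖ρ^{T_β}‖₁ - 1) / 2` in the bipartition `α | β`. -/
def negativity {α β : Type} [Fintype α] [DecidableEq α] [Fintype β] [DecidableEq β]
    (ρ : Op (α × β)) : ℝ :=
  (traceNorm (partialTranspose ρ) - 1) / 2

/-- The negativity `E^{AB|C}` of an operator on `A ⊗ (B ⊗ C)` in the bipartition `AB | C`. -/
def negativityABC {A B C : Type} [Fintype A] [DecidableEq A] [Fintype B] [DecidableEq B]
    [Fintype C] [DecidableEq C] (ρ : Op (A × (B × C))) : ℝ :=
  negativity (Matrix.reindex (Equiv.prodAssoc A B C).symm (Equiv.prodAssoc A B C).symm ρ)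

/-- A quantum evolution `(Λ_t)_{t ≥ 0}` of a system of dimension `d`: a family of quantum
operations that starts from the identity, is continuous on `[0, ∞)` and is differentiable in time on
`(0, ∞)`; in finite dimension both are expressed through the matrix entries of `Λ_t[X]`. The values
at negative times play no role. -/
structure IsEvolution {d : ℕ} (Λ : ℝ → Op (Fin d) →ₗ[ℂ] Op (Fin d)) : Prop where
  cptp : ∀ t : ℝ, 0 ≤ t → IsCPTP (Λ t)
  initial : Λ 0 = LinearMap.id
  continuousOn : ∀ (X : Op (Fin d)) (i j : Fin d),
    ContinuousOn (fun t : ℝ => Λ t X i j) (Set.Ici 0)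
  differentiableOn : ∀ (X : Op (Fin d)) (i j : Fin d),
    DifferentiableOn ℝ (fun t : ℝ => Λ t X i j) (Set.Ioi 0)

/-- CP-divisibility (Markovianity): for all `0 ≤ s ≤ t` there is a quantum operation `V` with
`Λ_t = V ∘ Λ_s`. -/
def IsMarkovian {d : ℕ} (Λ : ℝ → Op (Fin d) →ₗ[ℂ] Op (Fin d)) : Prop :=
  ∀ s t : ℝ, 0 ≤ s → s ≤ t → ∃ V : Op (Fin d) →ₗ[ℂ] Op (Fin d), IsCPTP V ∧ Λ t = V ∘ₗ Λ s

/-- Invertibility of an evolution: every `Λ_t` has a linear inverse, which need not be positive. -/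
def IsInvertibleEvolution {d : ℕ} (Λ : ℝ → Op (Fin d) →ₗ[ℂ] Op (Fin d)) : Prop :=
  ∀ t : ℝ, 0 ≤ t → ∃ L : Op (Fin d) →ₗ[ℂ] Op (Fin d), L ∘ₗ Λ t = LinearMap.id

end

/-! Argue by contraposition: if no negativity ever has a positive derivative, every propagator is a
quantum operation.

For Hermitian `X` on `A` and an ancilla, `negativityProbe` is an unnormalized state on which
negativity reads out a trace norm. Its partial transpose evolves into `Y ⊗ ψ + Z ⊗ (1 - ψ)`, with
`ψ` the antisymmetric projection of two qubits, `Y` the evolved `X` and `Z ≥ 0` of constant trace.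
The negativity of the normalized probe is thus an increasing affine function of `‖Y‖₁`, so no such
trace norm has a positive derivative (`hasNoTraceNormIncrease_of_negativity`).

The trace norm need not be differentiable at singular operators. At invertible ones it is
(`hasDerivAt_traceNorm`), and there a nonpositive derivative gives `‖Y‖₁ ≤ ‖Y - s D‖₁` for all `s ≥
0`, where `D` is the derivative of `Y`. This inequality survives limits, so it extends to all `X`
once the range of `Λ t` contains an invertible Hermitian operator. A qubit channel without one is
constant and is treated directly. Hence all trace norms are nonincreasing
(`HasNoTraceNormIncrease.antitoneOn`).

If `Λ s` is injective, `Λ t ∘ (Λ s)⁻¹` preserves trace and contracts the trace norms of Hermitian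
operators with any ancilla, hence is completely positive.

For a qubit with `Λ s` not injective, consider the first noninjective time. Propagators leading up
to it accumulate at a noninjective channel fixing the range, which bounds the rank by two
(`finrank_range_le_two`). Kernels only grow, so the bound persists. A range of rank at most two is a
line spanned by a state or is spanned by two pure states; in the latter case the Alberti–Uhlmann
theorem (`exists_isCPTP_of_traceNorm_le`) supplies the propagator. -/

open Matrix Filter Topology Set

/-! ### Trace norm of Hermitian matrices. -/

section TraceNorm

variable {n m : Type} [Fintype n] [DecidableEq n] [Fintype m] [DecidableEq m]

theorem traceNorm_eq_trace_abs (X : Op n) : traceNorm X = (CFC.abs X).trace.re := rfl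

theorem continuous_traceNorm : Continuous (traceNorm : Op n → ℝ) := by
  have h : Continuous fun X : Op n => (CFC.abs X).trace.re :=
    Complex.continuous_re.comp ((CFC.continuous_abs).matrix_trace)
  exact h

theorem traceNorm_nonneg (X : Op n) : 0 ≤ traceNorm X := by
  have h := (nonneg_iff_posSemidef.1 (CFC.abs_nonneg X)).trace_nonneg
  exact (Complex.le_def.1 h).1

theorem posSemidef_abs (X : Op n) : (CFC.abs X).PosSemidef :=
  nonneg_iff_posSemidef.1 (CFC.abs_nonneg X)

theorem Matrix.PosSemidef.traceNorm_eq {X : Op n} (hX : X.PosSemidef) :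
    traceNorm X = X.trace.re := by
  rw [traceNorm_eq_trace_abs, CFC.abs_of_nonneg X (nonneg_iff_posSemidef.2 hX)]

theorem traceNorm_smul_of_nonneg {a : ℝ} (ha : 0 ≤ a) (X : Op n) :
    traceNorm ((a : ℂ) • X) = a * traceNorm X := by
  rw [traceNorm_eq_trace_abs, CFC.abs_smul, Complex.norm_real, Real.norm_of_nonneg ha,
    trace_smul, traceNorm_eq_trace_abs]
  simp

theorem eq_zero_of_traceNorm_eq_zero {X : Op n} (hX : traceNorm X = 0) : X = 0 := by
  have h0 := (posSemidef_abs X).trace_nonneg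
  have h1 : (CFC.abs X).trace = 0 := by
    apply Complex.ext
    · exact hX
    · exact (Complex.le_def.1 h0).2.symm
  exact CFC.abs_eq_zero_iff.1 ((posSemidef_abs X).trace_eq_zero_iff.1 h1)

theorem sub_le_abs {X : Op n} (hX : X.IsHermitian) : (CFC.abs X - X).PosSemidef := by
  have hX' : IsSelfAdjoint X := hX
  rw [CFC.abs_sub_self X hX', ← nonneg_iff_posSemidef]
  exact nsmul_nonneg (CFC.negPart_nonneg X) 2

theorem add_le_abs {X : Op n} (hX : X.IsHermitian) : (CFC.abs X + X).PosSemidef := by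
  have hX' : IsSelfAdjoint X := hX
  rw [CFC.abs_add_self X hX', ← nonneg_iff_posSemidef]
  exact nsmul_nonneg (CFC.posPart_nonneg X) 2

/-- `CFC.abs X - X` is positive semidefinite with nonpositive trace, hence zero. -/
theorem Matrix.PosSemidef.of_traceNorm_le {X : Op n} (hX : X.IsHermitian)
    (h : traceNorm X ≤ X.trace.re) : X.PosSemidef := by
  have hp := sub_le_abs hX
  have h1 := Complex.le_def.1 hp.trace_nonneg
  rw [trace_sub] at h1
  have h2 : (CFC.abs X - X).trace = 0 := by
    rw [trace_sub]
    apply Complex.ext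
    · have := h1.1
      rw [traceNorm_eq_trace_abs] at h
      simp only [Complex.sub_re, Complex.zero_re] at this ⊢
      linarith
    · exact h1.2.symm
  rw [hp.trace_eq_zero_iff, sub_eq_zero] at h2
  rw [← h2]
  exact posSemidef_abs X

theorem trace_mul_re_nonneg {A B : Op n} (hA : A.PosSemidef) (hB : B.PosSemidef) :
    0 ≤ (A * B).trace.re := by
  obtain ⟨R, rfl⟩ := CStarAlgebra.nonneg_iff_eq_star_mul_self.1 (nonneg_iff_posSemidef.2 hA)
  rw [← Matrix.trace_mul_cycle]
  have := (hB.mul_mul_conjTranspose_same R).trace_nonneg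
  exact (Complex.le_def.1 this).1

/-- A Hermitian involution is a lower bound certificate for the trace norm. -/
theorem trace_mul_re_le_traceNorm {S X : Op n} (hS : S.IsHermitian) (hS2 : S * S = 1)
    (hX : X.IsHermitian) : (S * X).trace.re ≤ traceNorm X := by
  -- `1 ± S` are twice projections. Pairing `1 + S` with `|X| - X` and `1 - S` with `|X| + X` and
  -- adding leaves `2 tr |X| - 2 tr (S X) ≥ 0`.
  have hp : (1 + S).PosSemidef := by
    have : (1 + S) = (2⁻¹ : ℂ) • ((1 + S)ᴴ * (1 + S)) := by
      rw [conjTranspose_add, hS.eq, conjTranspose_one, add_mul, mul_add, mul_add, hS2]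
      simp only [mul_one, one_mul]
      module
    rw [this]
    exact (posSemidef_conjTranspose_mul_self _).smul (by norm_num [Complex.le_def])
  have hm : (1 - S).PosSemidef := by
    have : (1 - S) = (2⁻¹ : ℂ) • ((1 - S)ᴴ * (1 - S)) := by
      rw [conjTranspose_sub, hS.eq, conjTranspose_one, sub_mul, mul_sub, mul_sub, hS2]
      simp only [mul_one, one_mul]
      module
    rw [this]
    exact (posSemidef_conjTranspose_mul_self _).smul (by norm_num [Complex.le_def])
  have h1 := trace_mul_re_nonneg hp (sub_le_abs hX)
  have h2 := trace_mul_re_nonneg hm (add_le_abs hX)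
  rw [traceNorm_eq_trace_abs]
  simp only [add_mul, sub_mul, mul_add, mul_sub, one_mul, trace_add, trace_sub, Complex.add_re,
    Complex.sub_re] at h1 h2
  linarith

theorem traceNorm_sub_le {A B : Op n} (hA : A.PosSemidef) (hB : B.PosSemidef) :
    traceNorm (A - B) ≤ A.trace.re + B.trace.re := by
  set X := A - B with hXdef
  have hX : X.IsHermitian := hA.1.sub hB.1
  -- The sign function takes the value 1 at 0, so that `S` is an involution even when `X` is
  -- singular.
  set s : ℝ → ℝ := fun x => if 0 ≤ x then 1 else -1
  have hc : ∀ g : ℝ → ℝ, ContinuousOn g (spectrum ℝ X) := fun g =>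
    (Matrix.finite_real_spectrum).continuousOn g
  have hX' : IsSelfAdjoint X := hX
  set S : Op n := cfc s X
  have hS : S.IsHermitian := cfc_predicate s X
  have hS2 : S * S = 1 := by
    rw [← cfc_mul s s X (hc _) (hc _), ← cfc_one ℝ X]
    congr 1
    funext x
    simp only [s]
    split_ifs <;> norm_num
  have hSX : S * X = CFC.abs X := by
    rw [CFC.abs_eq_cfc_norm X hX']
    conv_lhs => rw [← cfc_id' ℝ X hX']
    rw [← cfc_mul s _ X (hc _) (hc _)]
    congr 1
    funext x
    simp only [s, Real.norm_eq_abs]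
    split_ifs with h
    · rw [abs_of_nonneg h, one_mul]
    · rw [abs_of_neg (not_le.1 h)]; ring
  have h1 := trace_mul_re_le_traceNorm hS hS2 hA.1
  have h2 := trace_mul_re_le_traceNorm (S := -S) hS.neg (by simpa using hS2) hB.1
  rw [hA.traceNorm_eq] at h1
  rw [hB.traceNorm_eq] at h2
  rw [traceNorm_eq_trace_abs, ← hSX, hXdef, mul_sub, trace_sub, Complex.sub_re]
  simp only [neg_mul, trace_neg, Complex.neg_re] at h2
  linarith

theorem traceNorm_eq_posPart_add_negPart {X : Op n} (hX : X.IsHermitian) :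
    traceNorm X = (X⁺).trace.re + (X⁻).trace.re := by
  have hX' : IsSelfAdjoint X := hX
  rw [traceNorm_eq_trace_abs, ← CFC.posPart_add_negPart X hX', trace_add, Complex.add_re]

theorem traceNorm_add_le {X Y : Op n} (hX : X.IsHermitian) (hY : Y.IsHermitian) :
    traceNorm (X + Y) ≤ traceNorm X + traceNorm Y := by
  have hX' : IsSelfAdjoint X := hX
  have hY' : IsSelfAdjoint Y := hY
  have h : X + Y = (X⁺ + Y⁺) - (X⁻ + Y⁻) := by
    conv_lhs => rw [← CFC.posPart_sub_negPart X hX', ← CFC.posPart_sub_negPart Y hY']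
    abel
  have p : ∀ Z : Op n, (Z⁺).PosSemidef := fun Z => nonneg_iff_posSemidef.1 (CFC.posPart_nonneg Z)
  have q : ∀ Z : Op n, (Z⁻).PosSemidef := fun Z => nonneg_iff_posSemidef.1 (CFC.negPart_nonneg Z)
  rw [h, traceNorm_eq_posPart_add_negPart hX, traceNorm_eq_posPart_add_negPart hY]
  refine (traceNorm_sub_le ((p X).add (p Y)) ((q X).add (q Y))).trans ?_
  simp only [trace_add, Complex.add_re]
  linarith

theorem exists_traceNorm_le_mul_norm (n : Type) [Fintype n] [DecidableEq n] :
    ∃ C : ℝ, 0 ≤ C ∧ ∀ X : Op n, traceNorm X ≤ C * ‖X‖ := by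
  set T : Op n →L[ℂ] ℂ := LinearMap.toContinuousLinearMap (traceLinearMap n ℂ ℂ)
  refine ⟨‖T‖, norm_nonneg _, fun X => ?_⟩
  calc traceNorm X ≤ ‖T (CFC.abs X)‖ := Complex.re_le_norm _
    _ ≤ ‖T‖ * ‖CFC.abs X‖ := T.le_opNorm _
    _ = ‖T‖ * ‖X‖ := by rw [CFC.norm_abs]

theorem traceNorm_reindex (e : n ≃ m) (X : Op n) :
    traceNorm (X.submatrix e.symm e.symm) = traceNorm X := by
  have h : CFC.abs (X.submatrix e.symm e.symm) = (CFC.abs X).submatrix e.symm e.symm := by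
    refine CFC.sqrt_unique ?_ ?_
    · rw [submatrix_mul_equiv, CFC.abs_mul_abs, star_eq_conjTranspose, star_eq_conjTranspose,
        conjTranspose_submatrix, submatrix_mul_equiv]
    · exact nonneg_iff_posSemidef.2 ((posSemidef_abs X).submatrix _)
  rw [traceNorm_eq_trace_abs, h, traceNorm_eq_trace_abs]
  simp only [trace, diag, submatrix_apply]
  exact congrArg Complex.re (e.symm.sum_comp fun i => CFC.abs X i i)

/-- The trace norm splits over orthogonal flags on an ancilla. -/
theorem traceNorm_kronecker_add {X Y : Op n} (hY : Y.PosSemidef) {ψ : Op m}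
    (hψ : ψ.IsHermitian) (hψ2 : ψ * ψ = ψ) :
    traceNorm (kroneckerMap (· * ·) X ψ + kroneckerMap (· * ·) Y (1 - ψ)) =
      (CFC.abs X).trace.re * ψ.trace.re + Y.trace.re * (1 - ψ).trace.re := by
  have hp : ψ.PosSemidef := by
    have := posSemidef_conjTranspose_mul_self ψ
    rwa [hψ.eq, hψ2] at this
  have hq2 : (1 - ψ) * (1 - ψ) = 1 - ψ := by
    rw [sub_mul, mul_sub ψ, hψ2]; simp
  have hqh : (1 - ψ).IsHermitian := isHermitian_one.sub hψ
  have hq : (1 - ψ).PosSemidef := by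
    have := posSemidef_conjTranspose_mul_self (1 - ψ)
    rwa [hqh.eq, hq2] at this
  have hpq : ψ * (1 - ψ) = 0 := by rw [mul_sub, hψ2, mul_one, sub_self]
  have hqp : (1 - ψ) * ψ = 0 := by rw [sub_mul, hψ2, one_mul, sub_self]
  -- Cross terms vanish by orthogonality of `ψ` and `1 - ψ`, so uniqueness of the positive square
  -- root gives the absolute value blockwise.
  have h : CFC.abs (kroneckerMap (· * ·) X ψ + kroneckerMap (· * ·) Y (1 - ψ)) =
      kroneckerMap (· * ·) (CFC.abs X) ψ + kroneckerMap (· * ·) Y (1 - ψ) := by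
    refine CFC.sqrt_unique ?_ ?_
    · simp only [star_eq_conjTranspose, conjTranspose_add, conjTranspose_kronecker, hψ.eq, hqh.eq,
        add_mul, mul_add, ← mul_kronecker_mul, hpq, hqp, hψ2, hq2, hY.1.eq, CFC.abs_mul_abs,
        kroneckerMap_zero_right _ (fun a : ℂ => mul_zero a)]
    · exact nonneg_iff_posSemidef.2 (((posSemidef_abs X).kronecker hp).add (hY.kronecker hq))
  have i1 : ψ.trace.im = 0 := (Complex.le_def.1 hp.trace_nonneg).2.symm
  have i2 : (1 - ψ).trace.im = 0 := (Complex.le_def.1 hq.trace_nonneg).2.symm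
  rw [traceNorm_eq_trace_abs, h, trace_add, trace_kronecker, trace_kronecker]
  simp only [Complex.add_re, Complex.mul_re, i1, i2, mul_zero, sub_zero]

end TraceNorm

/-! ### Ampliations, and complete positivity through trace norm contraction. -/

section Ampliation

variable {n : Type} {β γ : Type}

theorem ampliation_apply (Φ : Op n →ₗ[ℂ] Op n) (X : Op (n × β)) (p q : n × β) :
    ampliation β Φ X p q = Φ (Matrix.of fun i j => X (i, p.2) (j, q.2)) p.1 q.1 := rfl

theorem ampliation_add (Φ : Op n →ₗ[ℂ] Op n) (X Y : Op (n × β)) :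
    ampliation β Φ (X + Y) = ampliation β Φ X + ampliation β Φ Y := by
  ext p q
  have : (Matrix.of fun i j => (X + Y) (i, p.2) (j, q.2)) =
      (Matrix.of fun i j => X (i, p.2) (j, q.2)) + Matrix.of fun i j => Y (i, p.2) (j, q.2) := rfl
  rw [Matrix.add_apply, ampliation_apply, this, map_add]
  rfl

theorem ampliation_smul (Φ : Op n →ₗ[ℂ] Op n) (c : ℂ) (X : Op (n × β)) :
    ampliation β Φ (c • X) = c • ampliation β Φ X := by
  ext p q
  have : (Matrix.of fun i j => (c • X) (i, p.2) (j, q.2)) =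
      c • (Matrix.of fun i j => X (i, p.2) (j, q.2)) := rfl
  rw [Matrix.smul_apply, ampliation_apply, this, map_smul]
  rfl

theorem ampliation_sub (Φ : Op n →ₗ[ℂ] Op n) (X Y : Op (n × β)) :
    ampliation β Φ (X - Y) = ampliation β Φ X - ampliation β Φ Y := by
  have h := ampliation_smul Φ (-1) Y
  rw [neg_one_smul, neg_one_smul] at h
  rw [sub_eq_add_neg, ampliation_add, h, ← sub_eq_add_neg]

theorem ampliation_comp (Φ Ψ : Op n →ₗ[ℂ] Op n) (X : Op (n × β)) :
    ampliation β (Φ ∘ₗ Ψ) X = ampliation β Φ (ampliation β Ψ X) := rfl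

theorem ampliation_kronecker (Φ : Op n →ₗ[ℂ] Op n) (A : Op n) (B : Op β) :
    ampliation β Φ (kroneckerMap (· * ·) A B) = kroneckerMap (· * ·) (Φ A) B := by
  ext p q
  have : (Matrix.of fun i j => kroneckerMap (· * ·) A B (i, p.2) (j, q.2)) = B p.2 q.2 • A := by
    ext i j
    simp [mul_comm]
  rw [ampliation_apply, this, map_smul]
  simp [mul_comm]

theorem ampliation_submatrix (Φ : Op n →ₗ[ℂ] Op n) (e : γ → β) (X : Op (n × β)) :
    ampliation γ Φ (X.submatrix (Prod.map id e) (Prod.map id e)) =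
      (ampliation β Φ X).submatrix (Prod.map id e) (Prod.map id e) := rfl

theorem exists_isHermitian_add_smul_I (X : Op n) :
    ∃ A B : Op n, A.IsHermitian ∧ B.IsHermitian ∧ X = A + Complex.I • B := by
  refine ⟨(2⁻¹ : ℂ) • (X + Xᴴ), (-Complex.I / 2) • (X - Xᴴ), ?_, ?_, ?_⟩
  · simp [IsHermitian, conjTranspose_smul, add_comm]
  · simp only [IsHermitian, conjTranspose_smul, conjTranspose_sub, conjTranspose_conjTranspose]
    rw [← neg_sub X Xᴴ, smul_neg, ← neg_smul]
    congr 1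
    simp
    ring
  · rw [smul_smul]
    have : Complex.I * (-Complex.I / 2) = 2⁻¹ := by
      linear_combination (-1 / 2 : ℂ) * Complex.I_mul_I
    rw [this]
    module

variable [Fintype n] [Fintype β]

/-- The definition only covers ancillas `Fin k`; relabelling reaches every finite type. -/
theorem IsCompletelyPositive.ampliation_posSemidef {Φ : Op n →ₗ[ℂ] Op n}
    (hΦ : IsCompletelyPositive Φ) {X : Op (n × β)} (hX : X.PosSemidef) :
    (ampliation β Φ X).PosSemidef := by
  classical
  let e := Fintype.equivFin β
  have h := hΦ _ _ (hX.submatrix (Prod.map id e.symm))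
  rw [ampliation_submatrix] at h
  have h2 := h.submatrix (Prod.map id e)
  have h3 : (Prod.map id e.symm : n × _ → n × β) ∘ Prod.map id e = id := by
    funext p; exact Prod.ext rfl (e.symm_apply_apply p.2)
  rwa [submatrix_submatrix, h3, submatrix_id_id] at h2

theorem IsCompletelyPositive.map_posSemidef {Φ : Op n →ₗ[ℂ] Op n}
    (hΦ : IsCompletelyPositive Φ) {X : Op n} (hX : X.PosSemidef) : (Φ X).PosSemidef :=
  (hΦ.ampliation_posSemidef (β := Unit) (hX.submatrix Prod.fst)).submatrix fun i => (i, ())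

theorem isHermitian_exists_sub [DecidableEq n] {X : Op n} (hX : X.IsHermitian) :
    ∃ A B : Op n, A.PosSemidef ∧ B.PosSemidef ∧ X = A - B ∧
      traceNorm X = A.trace.re + B.trace.re := by
  have hX' : IsSelfAdjoint X := hX
  exact ⟨X⁺, X⁻, nonneg_iff_posSemidef.1 (CFC.posPart_nonneg X),
    nonneg_iff_posSemidef.1 (CFC.negPart_nonneg X), (CFC.posPart_sub_negPart X hX').symm,
    traceNorm_eq_posPart_add_negPart hX⟩

theorem IsCompletelyPositive.ampliation_isHermitian [DecidableEq n] [DecidableEq β]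
    {Φ : Op n →ₗ[ℂ] Op n}
    (hΦ : IsCompletelyPositive Φ) {X : Op (n × β)} (hX : X.IsHermitian) :
    (ampliation β Φ X).IsHermitian := by
  obtain ⟨A, B, hA, hB, rfl, -⟩ := isHermitian_exists_sub hX
  rw [ampliation_sub]
  exact (hΦ.ampliation_posSemidef hA).1.sub (hΦ.ampliation_posSemidef hB).1

theorem IsCompletelyPositive.map_isHermitian [DecidableEq n] {Φ : Op n →ₗ[ℂ] Op n}
    (hΦ : IsCompletelyPositive Φ) {X : Op n} (hX : X.IsHermitian) : (Φ X).IsHermitian := by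
  obtain ⟨A, B, hA, hB, rfl, -⟩ := isHermitian_exists_sub hX
  rw [map_sub]
  exact (hΦ.map_posSemidef hA).1.sub (hΦ.map_posSemidef hB).1

theorem IsCompletelyPositive.map_conjTranspose [DecidableEq n] {Φ : Op n →ₗ[ℂ] Op n}
    (hΦ : IsCompletelyPositive Φ) (X : Op n) : Φ Xᴴ = (Φ X)ᴴ := by
  obtain ⟨A, B, hA, hB, rfl⟩ := exists_isHermitian_add_smul_I X
  simp only [conjTranspose_add, conjTranspose_smul, hA.eq, hB.eq, map_add, map_smul,
    (hΦ.map_isHermitian hA).eq, (hΦ.map_isHermitian hB).eq]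

theorem trace_ampliation {Φ : Op n →ₗ[ℂ] Op n} (hΦ : ∀ X : Op n, (Φ X).trace = X.trace)
    (X : Op (n × β)) : (ampliation β Φ X).trace = X.trace := by
  simp only [trace, diag, Fintype.sum_prod_type_right, ampliation_apply]
  refine Finset.sum_congr rfl fun b _ => ?_
  exact hΦ (Matrix.of fun i j => X (i, b) (j, b))

theorem IsCPTP.traceNorm_ampliation_le [DecidableEq n] [DecidableEq β] {Φ : Op n →ₗ[ℂ] Op n}
    (hΦ : IsCPTP Φ) {X : Op (n × β)} (hX : X.IsHermitian) :
    traceNorm (ampliation β Φ X) ≤ traceNorm X := by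
  obtain ⟨A, B, hA, hB, rfl, h⟩ := isHermitian_exists_sub hX
  rw [h, ampliation_sub, ← trace_ampliation hΦ.trace_map A, ← trace_ampliation hΦ.trace_map B]
  exact traceNorm_sub_le (hΦ.1.ampliation_posSemidef hA) (hΦ.1.ampliation_posSemidef hB)

/-- A trace-preserving map whose ampliations contract the trace norm of Hermitian operators is
completely positive. -/
theorem IsCPTP.of_traceNorm_ampliation_le [DecidableEq n] {Φ : Op n →ₗ[ℂ] Op n}
    (htr : ∀ X : Op n, (Φ X).trace = X.trace)
    (hher : ∀ X : Op n, X.IsHermitian → (Φ X).IsHermitian)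
    (h : ∀ (k : ℕ) (X : Op (n × Fin k)), X.IsHermitian →
      traceNorm (ampliation (Fin k) Φ X) ≤ traceNorm X) : IsCPTP Φ := by
  have hct : ∀ X : Op n, Φ Xᴴ = (Φ X)ᴴ := by
    intro X
    obtain ⟨A, B, hA, hB, rfl⟩ := exists_isHermitian_add_smul_I X
    simp only [conjTranspose_add, conjTranspose_smul, hA.eq, hB.eq, map_add, map_smul,
      (hher A hA).eq, (hher B hB).eq]
  refine ⟨fun k X hX => ?_, htr⟩
  -- For positive `X` the trace norm is the trace. Contraction and trace preservation keep the
  -- image's trace norm at most its trace, which forces positivity.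
  refine PosSemidef.of_traceNorm_le ?_ ?_
  · ext p q
    have h1 := congrFun (congrFun (hct (Matrix.of fun i j => X (i, q.2) (j, p.2))) p.1) q.1
    rw [conjTranspose_apply] at h1 ⊢
    rw [ampliation_apply, ampliation_apply, ← h1]
    have h2 : (Matrix.of fun i j => X (i, q.2) (j, p.2))ᴴ =
        Matrix.of fun i j => X (i, p.2) (j, q.2) := by
      ext i j
      exact hX.1.apply _ _
    rw [h2]
  · rw [trace_ampliation htr, ← hX.traceNorm_eq]
    exact h k X hX.1

end Ampliation

/-! ### Differentiating the trace norm at invertible operators. -/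

section Evolution

variable {n : Type} [Fintype n] [DecidableEq n]

theorem hasDerivAt_matrix {F : ℝ → Op n} {D : Op n} {t : ℝ}
    (h : ∀ i j, HasDerivAt (fun τ => F τ i j) (D i j) t) : HasDerivAt F D t := by
  have h1 : F = fun τ => ∑ i, ∑ j, (F τ i j) • (single i j 1 : Op n) := by
    funext τ
    conv_lhs => rw [matrix_eq_sum_single (F τ)]
    simp [smul_single]
  have h2 : D = ∑ i, ∑ j, (D i j) • (single i j 1 : Op n) := by
    conv_lhs => rw [matrix_eq_sum_single D]
    simp [smul_single]
  rw [h1, h2]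
  exact HasDerivAt.fun_sum fun i _ => HasDerivAt.fun_sum fun j _ => (h i j).smul_const _

theorem hasDerivAt_trace_re {F : ℝ → Op n} {D : Op n} {t : ℝ} (h : HasDerivAt F D t) :
    HasDerivAt (fun τ => (F τ).trace.re) D.trace.re t := by
  set T : Op n →L[ℝ] ℝ := LinearMap.toContinuousLinearMap
    (Complex.reLm ∘ₗ (traceLinearMap n ℂ ℂ).restrictScalars ℝ)
  exact T.hasFDerivAt.comp_hasDerivAt t h

/-- The trace norm is differentiable along a differentiable curve of Hermitian operators wherever
the curve is invertible. -/
theorem hasDerivAt_traceNorm {F : ℝ → Op n} {D : Op n} {t : ℝ}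
    (hF : ∀ᶠ τ in 𝓝 t, (F τ).IsHermitian) (hD : HasDerivAt F D t) (hu : IsUnit (F t)) :
    ∃ S : Op n, S.IsHermitian ∧ S * S = 1 ∧ (S * F t).trace.re = traceNorm (F t) ∧
      HasDerivAt (fun τ => traceNorm (F τ)) (S * D).trace.re t := by
  have hX : (F t).IsHermitian := hF.self_of_nhds
  set X := F t with hXdef
  set A := CFC.abs X with hA
  have hAA : A * A = X * X := by
    rw [hA, CFC.abs_mul_abs, star_eq_conjTranspose, hX.eq]
  have hAp : A.PosSemidef := posSemidef_abs X
  have hAu : IsUnit A := by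
    have : IsUnit (A * A) := by rw [hAA]; exact hu.mul hu
    exact (isUnit_iff_isUnit_det _).2 (isUnit_of_mul_isUnit_left
      (by rw [← det_mul]; exact (isUnit_iff_isUnit_det _).1 this))
  have hAd : IsUnit A.det := (isUnit_iff_isUnit_det _).1 hAu
  have hcomm : A * X = X * A := (CFC.commute_abs_self X (IsSelfAdjoint.isStarNormal hX)).eq
  set B := A⁻¹ with hB
  have hBp : B.PosSemidef := hAp.inv
  have hAB : A * B = 1 := mul_nonsing_inv _ hAd
  have hBA : B * A = 1 := nonsing_inv_mul _ hAd
  have hcommB : B * X = X * B := by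
    calc B * X = B * X * (A * B) := by rw [hAB, mul_one]
      _ = B * (X * A) * B := by simp only [mul_assoc]
      _ = B * (A * X) * B := by rw [hcomm]
      _ = (B * A) * X * B := by simp only [mul_assoc]
      _ = X * B := by rw [hBA, one_mul]
  obtain ⟨S, hS⟩ : ∃ S, S = B * X := ⟨_, rfl⟩
  have hSh : S.IsHermitian := by
    rw [IsHermitian, hS, conjTranspose_mul, hX.eq, hBp.1.eq, hcommB]
  have hS2 : S * S = 1 := by
    calc S * S = B * (X * B) * X := by simp only [hS, mul_assoc]
      _ = B * (B * X) * X := by rw [hcommB]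
      _ = B * B * (X * X) := by simp only [mul_assoc]
      _ = B * B * (A * A) := by rw [hAA]
      _ = B * (B * A) * A := by simp only [mul_assoc]
      _ = 1 := by rw [hBA, mul_one, hBA]
  have hSX : S * X = A := by
    calc S * X = B * (X * X) := by simp only [hS, mul_assoc]
      _ = B * A * A := by rw [← hAA, mul_assoc]
      _ = A := by rw [hBA, one_mul]
  have hSXt : (S * X).trace.re = traceNorm X := by rw [hSX]; rfl
  refine ⟨S, hSh, hS2, hSXt, ?_⟩
  -- The trace norm is squeezed between two functions that touch it at `t` with equal slope: `tr (S
  -- F)` below, and above a bound quadratic in `F`, obtained from `tr ((|F| - A) A⁻¹ (|F| - A)) ≥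
  -- 0`.
  have hlow : HasDerivAt (fun τ => (S * F τ).trace.re) (S * D).trace.re t :=
    hasDerivAt_trace_re (hD.const_mul S)
  have hup : HasDerivAt (fun τ => 2⁻¹ * ((B * (F τ * F τ)).trace.re + A.trace.re))
      (S * D).trace.re t := by
    have h1 := ((hasDerivAt_trace_re ((hD.fun_mul hD).const_mul B)).add_const A.trace.re).const_mul
      (2⁻¹ : ℝ)
    have e1 : (B * (D * X)).trace = (S * D).trace := by
      rw [← mul_assoc, trace_mul_comm, ← mul_assoc, ← hcommB, hS]
    have e2 : (B * (X * D)).trace = (S * D).trace := by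
      rw [hS, mul_assoc]
    rw [← hXdef, mul_add, trace_add, e1, e2, Complex.add_re] at h1
    have e3 : 2⁻¹ * ((S * D).trace.re + (S * D).trace.re) = (S * D).trace.re := by ring
    rwa [e3] at h1
  have hlowle : ∀ᶠ τ in 𝓝 t, (S * F τ).trace.re ≤ traceNorm (F τ) := by
    filter_upwards [hF] with τ hτ using trace_mul_re_le_traceNorm hSh hS2 hτ
  have huple : ∀ᶠ τ in 𝓝 t, traceNorm (F τ) ≤ 2⁻¹ * ((B * (F τ * F τ)).trace.re + A.trace.re) := by
    filter_upwards [hF] with τ hτ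
    set Y := CFC.abs (F τ) with hY
    have hYY : Y * Y = F τ * F τ := by
      rw [hY, CFC.abs_mul_abs, star_eq_conjTranspose, hτ.eq]
    have hYh : Y.IsHermitian := (posSemidef_abs _).1
    have hp : ((Y - A)ᴴ * B * (Y - A)).PosSemidef := hBp.conjTranspose_mul_mul_same _
    have h0 := (Complex.le_def.1 hp.trace_nonneg).1
    have e : (Y - A)ᴴ * B * (Y - A) = Y * B * Y - Y - Y + A := by
      rw [conjTranspose_sub, hYh.eq, hAp.1.eq, sub_mul, hAB, mul_sub, sub_mul, sub_mul,
        mul_assoc Y B A, hBA]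
      simp only [mul_one, one_mul]
      abel
    rw [e, trace_add, trace_sub, trace_sub, trace_mul_comm, ← mul_assoc, hYY, trace_mul_comm] at h0
    simp only [Complex.add_re, Complex.sub_re, Complex.zero_re] at h0
    rw [traceNorm_eq_trace_abs, ← hY]
    linarith
  have et : traceNorm (F t) = 2⁻¹ * ((B * (F t * F t)).trace.re + A.trace.re) := by
    rw [← hXdef, ← mul_assoc, ← hS, hSX, traceNorm_eq_trace_abs, ← hA]; ring
  rw [hasDerivAt_iff_isLittleO] at hlow hup ⊢
  have hsum := hlow.norm_norm.add hup.norm_norm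
  refine Asymptotics.IsBigO.trans_isLittleO (Asymptotics.IsBigO.of_bound 1 ?_)
    (Asymptotics.isLittleO_norm_right.1 hsum)
  filter_upwards [hlowle, huple] with τ h1 h2
  rw [← hXdef] at et
  rw [one_mul, ← hXdef, hSXt, ← et]
  rw [Real.norm_of_nonneg (add_nonneg (norm_nonneg _) (norm_nonneg _)), Real.norm_eq_abs, abs_le]
  constructor
  · have := neg_abs_le ((S * F τ).trace.re - traceNorm X - (τ - t) • (S * D).trace.re)
    have := norm_nonneg (2⁻¹ * ((B * (F τ * F τ)).trace.re + A.trace.re) - traceNorm X -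
      (τ - t) • (S * D).trace.re)
    simp only [Real.norm_eq_abs] at *
    linarith
  · have := le_abs_self (2⁻¹ * ((B * (F τ * F τ)).trace.re + A.trace.re) - traceNorm X -
      (τ - t) • (S * D).trace.re)
    have := norm_nonneg ((S * F τ).trace.re - traceNorm X - (τ - t) • (S * D).trace.re)
    simp only [Real.norm_eq_abs] at *
    linarith

end Evolution

/-! ### Monotonicity criterion, constant channels and invertible perturbations. -/

section Monotonicity

/-- Reversing time, `u ↦ -f (b - u)` has right slopes with nonpositive lower limit, and a continuous
function with this property cannot increase; `f` need not be differentiable. -/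
theorem antitoneOn_of_left_lower_bound {f : ℝ → ℝ} (hf : ContinuousOn f (Ici 0))
    (h : ∀ t, 0 < t → ∀ ε, 0 < ε → ∀ᶠ s in 𝓝[>] (0 : ℝ), f t ≤ f (t - s) + ε * s) :
    AntitoneOn f (Ici 0) := by
  intro a ha b hb hab
  have key := image_le_of_liminf_slope_right_le_deriv_boundary
    (f := fun u => -f (b - u)) (a := 0) (b := b - a) (B := fun _ => -f b) (B' := fun _ => 0)
    ?_ (by simp) continuousOn_const (fun x _ => hasDerivWithinAt_const _ _ _) ?_
    (x := b - a) ⟨by linarith, le_rfl⟩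
  · simpa using key
  · refine (hf.comp (by fun_prop) ?_).neg
    intro u hu
    simp only [mem_Icc, mem_Ici] at *
    linarith
  · intro u hu r hr
    have hu' : 0 < b - u := by
      simp only [mem_Ico, mem_Ici] at *
      linarith
    refine Eventually.frequently ?_
    have h1 := h (b - u) hu' (r / 2) (by linarith)
    have h2 : Tendsto (fun z : ℝ => z - u) (𝓝[>] u) (𝓝[>] 0) := by
      refine tendsto_nhdsWithin_iff.2 ⟨?_, ?_⟩
      · have : Tendsto (fun z : ℝ => z - u) (𝓝 u) (𝓝 (u - u)) := by
          apply Continuous.tendsto; fun_prop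
        rw [sub_self] at this
        exact this.mono_left nhdsWithin_le_nhds
      · filter_upwards [self_mem_nhdsWithin] with z hz
        simpa using hz
    filter_upwards [h2.eventually h1, self_mem_nhdsWithin] with z hz hz'
    have hz'' : 0 < z - u := sub_pos.2 hz'
    have e : b - u - (z - u) = b - z := by ring
    rw [e] at hz
    rw [slope_def_field, div_lt_iff₀ hz'']
    nlinarith

/-- The constant channel `Y ↦ tr(Y) P`. -/
def constantChannel {n : Type} [Fintype n] (P : Op n) : Op n →ₗ[ℂ] Op n :=
  (traceLinearMap n ℂ ℂ).smulRight P

theorem constantChannel_apply {n : Type} [Fintype n] (P Y : Op n) :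
    constantChannel P Y = Y.trace • P := rfl

theorem isCPTP_constantChannel {n : Type} [Fintype n] {P : Op n} (hP : IsState P) : IsCPTP (constantChannel P) := by
  refine ⟨fun k X hX => ?_, fun X => ?_⟩
  · have h : ampliation (Fin k) (constantChannel P) X =
        kroneckerMap (· * ·) P (∑ l, X.submatrix (fun a => (l, a)) fun a => (l, a)) := by
      ext p q
      rw [ampliation_apply, constantChannel_apply]
      simp [trace, Matrix.sum_apply, mul_comm]
    rw [h]
    exact hP.1.kronecker (posSemidef_sum _ fun l _ => hX.submatrix _)
  · rw [constantChannel_apply, trace_smul, hP.2, smul_eq_mul, mul_one]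

variable {n : Type} [Fintype n] [DecidableEq n]

/-- `M + ε K` is singular only when `-ε` is one of the finitely many eigenvalues of `K⁻¹ M`. -/
theorem eventually_isUnit_add_smul (M : Op n) {K : Op n} (hK : IsUnit K) :
    ∀ᶠ ε : ℝ in 𝓝[>] 0, IsUnit (M + (ε : ℂ) • K) := by
  have hKd : IsUnit K.det := (isUnit_iff_isUnit_det _).1 hK
  have hfin : (spectrum ℂ (K⁻¹ * M)).Finite := Matrix.finite_spectrum _
  have hfin2 : {ε : ℝ | (-(ε : ℂ)) ∈ spectrum ℂ (K⁻¹ * M)}.Finite :=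
    hfin.preimage (fun x _ y _ hxy => by simpa using hxy)
  have h1 : ∀ᶠ ε : ℝ in 𝓝[>] 0, ε ∉ {ε : ℝ | (-(ε : ℂ)) ∈ spectrum ℂ (K⁻¹ * M)} \ {0} := by
    refine nhdsWithin_le_nhds ?_
    exact (hfin2.subset sdiff_subset).isClosed.isOpen_compl.mem_nhds (by simp)
  filter_upwards [h1, self_mem_nhdsWithin] with ε hε hpos
  have h2 : (-(ε : ℂ)) ∉ spectrum ℂ (K⁻¹ * M) := fun hmem =>
    hε ⟨hmem, fun h0 => (ne_of_gt hpos) h0⟩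
  rw [spectrum.notMem_iff] at h2
  have h3 : M + (ε : ℂ) • K = -(K * (algebraMap ℂ (Op n) (-(ε : ℂ)) - K⁻¹ * M)) := by
    rw [mul_sub, ← mul_assoc, mul_nonsing_inv _ hKd, one_mul, Algebra.algebraMap_eq_smul_one,
      mul_smul_comm, mul_one]
    module
  rw [h3]
  exact (hK.mul h2).neg

theorem HasDerivAt.isHermitian {F : ℝ → Op n} {D : Op n} {t : ℝ} (hD : HasDerivAt F D t)
    (hF : ∀ᶠ τ in 𝓝 t, (F τ).IsHermitian) : D.IsHermitian := by
  have h1 : HasDerivAt (fun τ => star (F τ)) (star D) t := hD.star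
  have h2 : HasDerivAt F (star D) t := h1.congr_of_eventuallyEq (by
    filter_upwards [hF] with τ hτ using hτ.eq.symm)
  exact h2.unique hD

end Monotonicity

/-! ### From nonpositive derivatives to nonincreasing trace norms and propagators. -/

section Evolution

variable {d : ℕ} {Λ : ℝ → Op (Fin d) →ₗ[ℂ] Op (Fin d)}

theorem IsEvolution.continuousOn_ampliation (hΛ : IsEvolution Λ) {β : Type} [Fintype β]
    [DecidableEq β] (X : Op (Fin d × β)) :
    ContinuousOn (fun t => ampliation β (Λ t) X) (Ici 0) :=
  continuousOn_pi.2 fun _ => continuousOn_pi.2 fun _ => hΛ.continuousOn _ _ _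

theorem IsEvolution.continuousOn_apply (hΛ : IsEvolution Λ) (X : Op (Fin d)) :
    ContinuousOn (fun t => Λ t X) (Ici 0) :=
  continuousOn_pi.2 fun _ => continuousOn_pi.2 fun _ => hΛ.continuousOn _ _ _

theorem IsEvolution.exists_hasDerivAt_ampliation (hΛ : IsEvolution Λ) {β : Type} [Fintype β]
    [DecidableEq β] (X : Op (Fin d × β)) {t : ℝ} (ht : 0 < t) :
    ∃ D, HasDerivAt (fun τ => ampliation β (Λ τ) X) D t := by
  refine ⟨Matrix.of fun p q => deriv (fun τ => ampliation β (Λ τ) X p q) t,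
    hasDerivAt_matrix fun p q => ?_⟩
  exact ((hΛ.differentiableOn _ _ _ t ht).differentiableAt (Ioi_mem_nhds ht)).hasDerivAt

theorem IsEvolution.eventually_isHermitian (hΛ : IsEvolution Λ) {β : Type} [Fintype β]
    [DecidableEq β] {X : Op (Fin d × β)} (hX : X.IsHermitian) {t : ℝ} (ht : 0 < t) :
    ∀ᶠ τ in 𝓝 t, (ampliation β (Λ τ) X).IsHermitian := by
  filter_upwards [Ioi_mem_nhds ht] with τ hτ
  exact (hΛ.cptp τ (le_of_lt hτ)).1.ampliation_isHermitian hX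

/-- The trace norm of every ancilla-assisted Hermitian operator has no positive derivative. -/
def HasNoTraceNormIncrease (Λ : ℝ → Op (Fin d) →ₗ[ℂ] Op (Fin d)) : Prop :=
  ∀ (k : ℕ) (X : Op (Fin d × Fin k)), X.IsHermitian → ∀ t : ℝ, 0 < t → ∀ r : ℝ,
    HasDerivAt (fun τ => traceNorm (ampliation (Fin k) (Λ τ) X)) r t → r ≤ 0

/-- The sign `S` of the evolved operator gives the lower bound `‖Y‖₁ - s tr (S D)`, and `tr (S D)`
is the derivative of the trace norm, hence nonpositive. -/
theorem HasNoTraceNormIncrease.le_traceNorm_sub_smul_of_isUnit (hΛ : IsEvolution Λ)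
    (hN : HasNoTraceNormIncrease Λ) {k : ℕ} {X D : Op (Fin d × Fin k)} (hX : X.IsHermitian)
    {t : ℝ} (ht : 0 < t) (hD : HasDerivAt (fun τ => ampliation (Fin k) (Λ τ) X) D t)
    (hu : IsUnit (ampliation (Fin k) (Λ t) X)) {s : ℝ} (hs : 0 ≤ s) :
    traceNorm (ampliation (Fin k) (Λ t) X) ≤
      traceNorm (ampliation (Fin k) (Λ t) X - (s : ℂ) • D) := by
  have hev := hΛ.eventually_isHermitian hX ht
  have hDh := hD.isHermitian hev
  obtain ⟨S, hS, hS2, hSX, hder⟩ := hasDerivAt_traceNorm hev hD hu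
  have hr := hN k X hX t ht _ hder
  have hh : (ampliation (Fin k) (Λ t) X - (s : ℂ) • D).IsHermitian :=
    hev.self_of_nhds.sub (by simp [IsHermitian, conjTranspose_smul, hDh.eq])
  have h := trace_mul_re_le_traceNorm hS hS2 hh
  rw [mul_sub, trace_sub, Complex.sub_re, hSX, mul_smul_comm, trace_smul, smul_eq_mul,
    Complex.re_ofReal_mul] at h
  nlinarith

/-- Shifting `X` by `ε (W ⊗ 1)` makes the evolved operator invertible for small `ε > 0`. Both sides
are continuous in `ε`, so the bound passes to `ε = 0` even where differentiability fails. -/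
theorem HasNoTraceNormIncrease.le_traceNorm_sub_smul (hΛ : IsEvolution Λ)
    (hN : HasNoTraceNormIncrease Λ) {k : ℕ} {X D : Op (Fin d × Fin k)} (hX : X.IsHermitian)
    {t : ℝ} (ht : 0 < t) (hD : HasDerivAt (fun τ => ampliation (Fin k) (Λ τ) X) D t)
    {W : Op (Fin d)} (hW : W.IsHermitian) (hu : IsUnit (Λ t W)) {s : ℝ} (hs : 0 ≤ s) :
    traceNorm (ampliation (Fin k) (Λ t) X) ≤
      traceNorm (ampliation (Fin k) (Λ t) X - (s : ℂ) • D) := by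
  set K : Op (Fin d × Fin k) := kroneckerMap (· * ·) W (1 : Op (Fin k)) with hK
  have hKh : K.IsHermitian := by
    rw [IsHermitian, hK, conjTranspose_kronecker, hW.eq, conjTranspose_one]
  have hKu : IsUnit (ampliation (Fin k) (Λ t) K) := by
    rw [hK, ampliation_kronecker, isUnit_iff_isUnit_det, det_kronecker]
    rw [isUnit_iff_isUnit_det] at hu
    simpa using hu.pow _
  obtain ⟨E, hE⟩ := hΛ.exists_hasDerivAt_ampliation K ht
  have hev := eventually_isUnit_add_smul (ampliation (Fin k) (Λ t) X) hKu
  have key : ∀ᶠ ε : ℝ in 𝓝[>] 0,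
      traceNorm (ampliation (Fin k) (Λ t) X + (ε : ℂ) • ampliation (Fin k) (Λ t) K) ≤
      traceNorm (ampliation (Fin k) (Λ t) X + (ε : ℂ) • ampliation (Fin k) (Λ t) K
        - (s : ℂ) • (D + (ε : ℂ) • E)) := by
    filter_upwards [hev] with ε hε
    have e : ∀ τ, ampliation (Fin k) (Λ τ) (X + (ε : ℂ) • K) =
        ampliation (Fin k) (Λ τ) X + (ε : ℂ) • ampliation (Fin k) (Λ τ) K := fun τ => by
      rw [ampliation_add, ampliation_smul]
    have hder : HasDerivAt (fun τ => ampliation (Fin k) (Λ τ) (X + (ε : ℂ) • K))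
        (D + (ε : ℂ) • E) t := by
      simp only [e]
      exact hD.add (hE.const_smul (ε : ℂ))
    rw [← e]
    refine hN.le_traceNorm_sub_smul_of_isUnit hΛ ?_ ht hder (by rwa [e]) hs
    exact hX.add (by simp [IsHermitian, conjTranspose_smul, hKh.eq])
  have c1 : Continuous fun ε : ℝ =>
      traceNorm (ampliation (Fin k) (Λ t) X + (ε : ℂ) • ampliation (Fin k) (Λ t) K) :=
    continuous_traceNorm.comp (by fun_prop)
  have c2 : Continuous fun ε : ℝ =>
      traceNorm (ampliation (Fin k) (Λ t) X + (ε : ℂ) • ampliation (Fin k) (Λ t) K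
        - (s : ℂ) • (D + (ε : ℂ) • E)) :=
    continuous_traceNorm.comp (by fun_prop)
  have := le_of_tendsto_of_tendsto ((c1.tendsto 0).mono_left nhdsWithin_le_nhds)
    ((c2.tendsto 0).mono_left nhdsWithin_le_nhds) key
  simpa using this

/-- If at every positive time the range of the evolution either contains an invertible Hermitian
operator or is spanned by a single state, then the absence of positive derivatives makes all the
trace norms nonincreasing. -/
theorem HasNoTraceNormIncrease.antitoneOn (hΛ : IsEvolution Λ) (hN : HasNoTraceNormIncrease Λ)
    (hgood : ∀ t : ℝ, 0 < t → (∃ W : Op (Fin d), W.IsHermitian ∧ IsUnit (Λ t W)) ∨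
      ∃ P : Op (Fin d), IsState P ∧ ∀ Y, Λ t Y = Y.trace • P)
    (k : ℕ) (X : Op (Fin d × Fin k)) (hX : X.IsHermitian) :
    AntitoneOn (fun τ => traceNorm (ampliation (Fin k) (Λ τ) X)) (Ici 0) := by
  refine antitoneOn_of_left_lower_bound
    (continuous_traceNorm.comp_continuousOn (hΛ.continuousOn_ampliation X)) fun t ht ε hε => ?_
  have hlt : ∀ᶠ s : ℝ in 𝓝[>] 0, s < t := nhdsWithin_le_nhds (Iio_mem_nhds ht)
  rcases hgood t ht with ⟨W, hW, hu⟩ | ⟨P, hP, hΛP⟩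
  · obtain ⟨D, hD⟩ := hΛ.exists_hasDerivAt_ampliation X ht
    have hDh := hD.isHermitian (hΛ.eventually_isHermitian hX ht)
    -- To first order, the operator at time `t - s` is the one at time `t` minus `s D`. The constant
    -- `C` converts the `o(s)` error to trace norm, and the tolerance `ε / (C + 1)` absorbs it
    -- without requiring `C > 0`.
    obtain ⟨C, hC, hCb⟩ := exists_traceNorm_le_mul_norm (Fin d × Fin k)
    have hlit := (hasDerivAt_iff_isLittleO.1 hD).def (c := ε / (C + 1)) (by positivity)
    have htend : Tendsto (fun s : ℝ => t - s) (𝓝[>] 0) (𝓝 t) := by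
      have : Tendsto (fun s : ℝ => t - s) (𝓝 0) (𝓝 (t - 0)) := by
        apply Continuous.tendsto; fun_prop
      rw [sub_zero] at this
      exact this.mono_left nhdsWithin_le_nhds
    filter_upwards [htend.eventually hlit, hlt, self_mem_nhdsWithin] with s hs hst hs0
    have hs0' : 0 < s := hs0
    have h1 := hN.le_traceNorm_sub_smul hΛ hX ht hD hW hu hs0'.le
    have hA := ((hΛ.cptp (t - s) (by linarith)).1.ampliation_isHermitian hX)
    have hB := ((hΛ.cptp t ht.le).1.ampliation_isHermitian hX)
    set A := ampliation (Fin k) (Λ (t - s)) X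
    set B := ampliation (Fin k) (Λ t) X
    have hR : (B - (s : ℂ) • D - A).IsHermitian :=
      (hB.sub (by simp [IsHermitian, conjTranspose_smul, hDh.eq])).sub hA
    have h2 := traceNorm_add_le hA hR
    rw [add_sub_cancel] at h2
    have h3 := hCb (B - (s : ℂ) • D - A)
    have h4 : ‖B - (s : ℂ) • D - A‖ ≤ ε / (C + 1) * s := by
      have e : A - B - (t - s - t) • D = -(B - (s : ℂ) • D - A) := by
        have : (t - s - t) • D = -((s : ℂ) • D) := by
          rw [show t - s - t = -s by ring, neg_smul, Complex.coe_smul]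
        rw [this]; abel
      rw [e, norm_neg, show t - s - t = -s by ring, norm_neg, Real.norm_of_nonneg hs0'.le] at hs
      exact hs
    have h5 : C * (ε / (C + 1) * s) ≤ ε * s := by
      have : C / (C + 1) ≤ 1 := by rw [div_le_one (by positivity)]; linarith
      calc C * (ε / (C + 1) * s) = (C / (C + 1)) * (ε * s) := by ring
        _ ≤ 1 * (ε * s) := by gcongr
        _ = ε * s := one_mul _
    have h6 : C * ‖B - (s : ℂ) • D - A‖ ≤ C * (ε / (C + 1) * s) := by gcongr
    change traceNorm B ≤ traceNorm A + ε * s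
    linarith
  · filter_upwards [hlt, self_mem_nhdsWithin] with s hst hs0
    have hs0' : 0 < s := hs0
    have hcp := hΛ.cptp (t - s) (by linarith)
    -- A constant map factors through every earlier one because trace is preserved, so plain channel
    -- contractivity suffices.
    have e : Λ t = constantChannel P ∘ₗ Λ (t - s) := by
      ext1 Y
      rw [LinearMap.comp_apply, constantChannel_apply, hcp.trace_map, hΛP]
    have h1 := (isCPTP_constantChannel hP).traceNorm_ampliation_le
      (hcp.1.ampliation_isHermitian hX)
    rw [← ampliation_comp, ← e] at h1
    have : 0 < ε * s := by positivity
    change traceNorm _ ≤ traceNorm _ + _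
    linarith

/-- For an injective `Λ s`, monotonicity of the trace norms yields the propagator. -/
theorem exists_isCPTP_comp_of_injective (hΛ : IsEvolution Λ)
    (hmono : ∀ (k : ℕ) (X : Op (Fin d × Fin k)), X.IsHermitian →
      AntitoneOn (fun τ => traceNorm (ampliation (Fin k) (Λ τ) X)) (Ici 0))
    {s t : ℝ} (hs : 0 ≤ s) (hst : s ≤ t) (hinj : Function.Injective (Λ s)) :
    ∃ V : Op (Fin d) →ₗ[ℂ] Op (Fin d), IsCPTP V ∧ Λ t = V ∘ₗ Λ s := by
  have ht : 0 ≤ t := hs.trans hst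
  let e := LinearEquiv.ofInjectiveEndo (Λ s) hinj
  have he : ∀ X, Λ s (e.symm X) = X := fun X => e.apply_symm_apply X
  have he' : ∀ X, e.symm (Λ s X) = X := fun X => e.symm_apply_apply X
  have hsH : ∀ X : Op (Fin d), (e.symm X)ᴴ = e.symm Xᴴ := by
    intro X
    apply hinj
    rw [(hΛ.cptp s hs).1.map_conjTranspose, he, he]
  have hcomp : Λ t = (Λ t ∘ₗ e.symm.toLinearMap) ∘ₗ Λ s := by
    ext1 X
    simp [he']
  refine ⟨Λ t ∘ₗ e.symm.toLinearMap, ?_, hcomp⟩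
  refine IsCPTP.of_traceNorm_ampliation_le (fun X => ?_) (fun X hX => ?_) fun k X hX => ?_
  · rw [LinearMap.comp_apply, (hΛ.cptp t ht).trace_map, ← (hΛ.cptp s hs).trace_map]
    exact congrArg trace (he X)
  · refine (hΛ.cptp t ht).1.map_isHermitian ?_
    change (e.symm X)ᴴ = e.symm X
    rw [hsH, hX.eq]
  -- `Λ s` carries the Hermitian operator `Y` to `X`, so contraction at `X` is exactly monotonicity
  -- along the orbit of `Y`.
  · set Y := ampliation (Fin k) e.symm.toLinearMap X
    have hY : Y.IsHermitian := by
      ext p q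
      change star (e.symm (Matrix.of fun i j => X (i, q.2) (j, p.2)) q.1 p.1) =
        e.symm (Matrix.of fun i j => X (i, p.2) (j, q.2)) p.1 q.1
      rw [← conjTranspose_apply, hsH]
      have : (Matrix.of fun i j => X (i, q.2) (j, p.2))ᴴ =
          Matrix.of fun i j => X (i, p.2) (j, q.2) := by
        ext i j
        exact hX.apply _ _
      rw [this]
    have h := hmono k Y hY hs ht hst
    have h1 : ampliation (Fin k) (Λ s) Y = X := by
      ext p q
      change Λ s (e.symm (Matrix.of fun i j => X (i, p.2) (j, q.2))) p.1 q.1 = X p q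
      rw [he]
      rfl
    simp only [h1] at h
    exact h

end Evolution

/-! ### Probe states whose negativity reads out a trace norm. -/

section Negativity

/-- The maximally entangled state of two qubits. -/
noncomputable def maxEntangled : Op (Fin 2 × Fin 2) :=
  Matrix.of fun p q => if p.1 = p.2 ∧ q.1 = q.2 then 1 / 2 else 0

/-- The projection onto the antisymmetric subspace of two qubits. -/
noncomputable def antisymProj : Op (Fin 2 × Fin 2) :=
  Matrix.of fun p q => ((if p = q then 1 else 0) - if p.1 = q.2 ∧ p.2 = q.1 then 1 else 0) / 2

theorem maxEntangled_posSemidef : maxEntangled.PosSemidef := by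
  have h : maxEntangled = (2⁻¹ : ℂ) • vecMulVec (fun p : Fin 2 × Fin 2 => if p.1 = p.2 then 1 else 0)
      (star fun p : Fin 2 × Fin 2 => if p.1 = p.2 then 1 else 0) := by
    ext p q
    by_cases hp : p.1 = p.2 <;> by_cases hq : q.1 = q.2 <;>
      simp [maxEntangled, vecMulVec_apply, hp, hq]
  rw [h]
  exact (posSemidef_vecMulVec_self_star _).smul (by norm_num [Complex.le_def])

theorem trace_maxEntangled : maxEntangled.trace = 1 := by
  simp [trace, maxEntangled, Fintype.sum_prod_type]

theorem antisymProj_isHermitian : antisymProj.IsHermitian := by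
  ext ⟨a, b⟩ ⟨a', b'⟩
  fin_cases a <;> fin_cases b <;> fin_cases a' <;> fin_cases b' <;>
    simp [antisymProj, conjTranspose_apply]

theorem antisymProj_mul_self : antisymProj * antisymProj = antisymProj := by
  ext ⟨a, b⟩ ⟨a', b'⟩
  fin_cases a <;> fin_cases b <;> fin_cases a' <;> fin_cases b' <;>
    norm_num [antisymProj, mul_apply, Fintype.sum_prod_type]

theorem trace_antisymProj : antisymProj.trace = 1 := by
  norm_num [trace, antisymProj, Fintype.sum_prod_type]

theorem ampliation_of_mul {n β γ : Type} (Φ : Op n →ₗ[ℂ] Op n) (Y : Op (n × γ)) (u : β → γ)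
    (w : β → β → ℂ) :
    ampliation β Φ (Matrix.of fun p q => Y (p.1, u p.2) (q.1, u q.2) * w p.2 q.2) =
      Matrix.of fun p q => ampliation γ Φ Y (p.1, u p.2) (q.1, u q.2) * w p.2 q.2 := by
  ext p q
  have : (Matrix.of fun i j => (Matrix.of fun p q : n × β =>
      Y (p.1, u p.2) (q.1, u q.2) * w p.2 q.2) (i, p.2) (j, q.2)) =
      w p.2 q.2 • Matrix.of fun i j => Y (i, u p.2) (j, u q.2) := by
    ext i j
    simp [mul_comm]
  rw [ampliation_apply, this, map_smul]
  simp [ampliation_apply, mul_comm]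

variable {d k : ℕ}

/-- Splitting a `2k`-dimensional ancilla into a `k`-dimensional one and a qubit. -/
def splitAncilla (d k : ℕ) :
    Fin d × (Fin (k * 2) × Fin 2) ≃ (Fin d × Fin k) × (Fin 2 × Fin 2) :=
  ((Equiv.refl (Fin d)).prodCongr ((finProdFinEquiv.symm.prodCongr (Equiv.refl (Fin 2))).trans
    (Equiv.prodAssoc _ _ _))).trans (Equiv.prodAssoc _ _ _).symm

/-- The unnormalized state whose partial transpose carries `X` on the antisymmetric subspace. -/
noncomputable def negativityProbe (X : Op (Fin d × Fin k)) (c : ℝ) : Op (Fin d × (Fin (k * 2) × Fin 2)) :=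
  (kroneckerMap (· * ·) ((2⁻¹ : ℂ) • ((c : ℂ) • 1 + X)) 1 +
    kroneckerMap (· * ·) ((c : ℂ) • 1 - X) maxEntangled).submatrix
      (splitAncilla d k) (splitAncilla d k)

theorem ampliation_negativityProbe (Φ : Op (Fin d) →ₗ[ℂ] Op (Fin d)) (X : Op (Fin d × Fin k))
    (c : ℝ) :
    ampliation _ Φ (negativityProbe X c) =
      (kroneckerMap (· * ·)
        ((2⁻¹ : ℂ) • (ampliation _ Φ ((c : ℂ) • 1) + ampliation _ Φ X)) 1 +
      kroneckerMap (· * ·) (ampliation _ Φ ((c : ℂ) • 1) - ampliation _ Φ X)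
        maxEntangled).submatrix (splitAncilla d k) (splitAncilla d k) := by
  let f : Fin (k * 2) ≃ Fin k × Fin 2 := finProdFinEquiv.symm
  rw [← ampliation_add, ← ampliation_sub, ← ampliation_smul]
  have h1 := ampliation_of_mul Φ ((2⁻¹ : ℂ) • ((c : ℂ) • 1 + X))
    (fun b : Fin (k * 2) × Fin 2 => (f b.1).1)
    (fun b b' => (1 : Op (Fin 2 × Fin 2)) ((f b.1).2, b.2) ((f b'.1).2, b'.2))
  have h2 := ampliation_of_mul Φ ((c : ℂ) • 1 - X)
    (fun b : Fin (k * 2) × Fin 2 => (f b.1).1)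
    (fun b b' => maxEntangled ((f b.1).2, b.2) ((f b'.1).2, b'.2))
  exact (ampliation_add Φ _ _).trans (congrArg₂ (· + ·) h1 h2)

/-- Partial transposition turns `maxEntangled` into half the swap, while `antisymProj` is `(1 -
swap) / 2`. Hence `½ (Z + Y) ⊗ 1 + (Z - Y) ⊗ swap / 2` regroups as `Y ⊗ ψ + Z ⊗ (1 - ψ)`. The factor
3 is the trace of `1 - ψ`, and `tr Z` does not depend on `Φ`. -/
theorem traceNorm_partialTranspose_negativityProbe {Φ : Op (Fin d) →ₗ[ℂ] Op (Fin d)}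
    (hΦ : IsCPTP Φ) (X : Op (Fin d × Fin k)) {c : ℝ} (hc : 0 ≤ c) :
    traceNorm (partialTranspose (Matrix.reindex (Equiv.prodAssoc _ _ _).symm
      (Equiv.prodAssoc _ _ _).symm (ampliation _ Φ (negativityProbe X c)))) =
      traceNorm (ampliation _ Φ X) + 3 * ((c : ℂ) • (1 : Op (Fin d × Fin k))).trace.re := by
  set Y := ampliation _ Φ X
  set J : Op (Fin d × Fin k) := (c : ℂ) • 1
  have hJ : J.PosSemidef := PosSemidef.one.smul (by simpa [Complex.le_def] using hc)
  set Z := ampliation _ Φ J with hZ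
  have hZp : Z.PosSemidef := hΦ.1.ampliation_posSemidef hJ
  let e : (Fin d × Fin k) × (Fin 2 × Fin 2) ≃ (Fin d × Fin (k * 2)) × Fin 2 :=
    ((Equiv.prodAssoc _ _ _).trans (splitAncilla d k)).symm
  have h : partialTranspose (Matrix.reindex (Equiv.prodAssoc _ _ _).symm
      (Equiv.prodAssoc _ _ _).symm (ampliation _ Φ (negativityProbe X c))) =
      (kroneckerMap (· * ·) Y antisymProj + kroneckerMap (· * ·) Z (1 - antisymProj)).submatrix
        e.symm e.symm := by
    rw [ampliation_negativityProbe]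
    ext ⟨⟨a, b⟩, j⟩ ⟨⟨a', b'⟩, j'⟩
    let f : Fin (k * 2) ≃ Fin k × Fin 2 := finProdFinEquiv.symm
    change (2⁻¹ * (Z (a, (f b).1) (a', (f b').1) + Y (a, (f b).1) (a', (f b').1))) *
        (1 : Op (Fin 2 × Fin 2)) ((f b).2, j') ((f b').2, j) +
      (Z (a, (f b).1) (a', (f b').1) - Y (a, (f b).1) (a', (f b').1)) *
        maxEntangled ((f b).2, j') ((f b').2, j) =
      Y (a, (f b).1) (a', (f b').1) * antisymProj ((f b).2, j) ((f b').2, j') +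
      Z (a, (f b).1) (a', (f b').1) *
        ((1 : Op (Fin 2 × Fin 2)) ((f b).2, j) ((f b').2, j') -
          antisymProj ((f b).2, j) ((f b').2, j'))
    generalize Z (a, (f b).1) (a', (f b').1) = z
    generalize Y (a, (f b).1) (a', (f b').1) = y
    generalize (f b).2 = i
    generalize (f b').2 = i'
    simp only [maxEntangled, antisymProj, of_apply, one_apply, Prod.mk.injEq]
    fin_cases i <;> fin_cases i' <;> fin_cases j <;> fin_cases j' <;> simp <;> ring
  rw [h, traceNorm_reindex,
    traceNorm_kronecker_add hZp antisymProj_isHermitian antisymProj_mul_self, trace_sub,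
    trace_antisymProj, hZ, trace_ampliation hΦ.trace_map, traceNorm_eq_trace_abs]
  norm_num [trace_one]
  ring

theorem exists_pos_smul_one_posSemidef {n : Type} [Fintype n] [DecidableEq n] {X : Op n}
    (hX : X.IsHermitian) :
    ∃ c : ℝ, 0 < c ∧ ((c : ℂ) • 1 + X).PosSemidef ∧ ((c : ℂ) • 1 - X).PosSemidef := by
  have hX' : IsSelfAdjoint X := hX
  have h1 := hX'.le_algebraMap_norm_self
  have h2 := hX'.neg_algebraMap_norm_le_self
  rw [le_iff, Algebra.algebraMap_eq_smul_one] at h1 h2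
  -- The added 1 keeps `c` positive when `X = 0`.
  refine ⟨‖X‖ + 1, by positivity, ?_, ?_⟩
  · have e : ((‖X‖ + 1 : ℝ) : ℂ) • (1 : Op n) + X = X - -(‖X‖ • 1) + 1 := by
      rw [Complex.coe_smul, add_smul, one_smul]
      abel
    rw [e]
    exact h2.add PosSemidef.one
  · have e : ((‖X‖ + 1 : ℝ) : ℂ) • (1 : Op n) - X = ‖X‖ • 1 - X + 1 := by
      rw [Complex.coe_smul, add_smul, one_smul]
      abel
    rw [e]
    exact h1.add PosSemidef.one

theorem negativityProbe_posSemidef {X : Op (Fin d × Fin k)} {c : ℝ}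
    (h1 : ((c : ℂ) • 1 + X).PosSemidef) (h2 : ((c : ℂ) • 1 - X).PosSemidef) :
    (negativityProbe X c).PosSemidef :=
  (((h1.smul (by norm_num [Complex.le_def])).kronecker PosSemidef.one).add
    (h2.kronecker maxEntangled_posSemidef)).submatrix _

theorem trace_negativityProbe (X : Op (Fin d × Fin k)) (c : ℝ) :
    (negativityProbe X c).trace =
      2 * ((c : ℂ) • 1 + X).trace + ((c : ℂ) • 1 - X).trace := by
  have h : ∀ M : Op ((Fin d × Fin k) × (Fin 2 × Fin 2)),
      (M.submatrix (splitAncilla d k) (splitAncilla d k)).trace = M.trace := fun M =>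
    (splitAncilla d k).sum_comp fun i => M i i
  rw [negativityProbe, h, trace_add, trace_kronecker, trace_kronecker, trace_maxEntangled,
    trace_one, trace_smul]
  norm_num
  ring

/-- After division by its trace `N`, the probe has negativity affine in the evolved trace norm with
slope `1 / (2 N) > 0`, so existence and sign of the derivative carry over. -/
theorem hasNoTraceNormIncrease_of_negativity {Λ : ℝ → Op (Fin d) →ₗ[ℂ] Op (Fin d)}
    (hΛ : IsEvolution Λ)
    (h : ∀ (dB dC : ℕ) (ρ : Op (Fin d × (Fin dB × Fin dC))), IsState ρ → ∀ t : ℝ, 0 < t →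
      ∀ r : ℝ, HasDerivAt
        (fun τ : ℝ => negativityABC (ampliation (Fin dB × Fin dC) (Λ τ) ρ)) r t → r ≤ 0) :
    HasNoTraceNormIncrease Λ := by
  intro k X hX t ht r hr
  -- In dimension zero the probe has zero trace and cannot be normalized, but the trace norm is then
  -- constant.
  rcases isEmpty_or_nonempty (Fin d × Fin k) with hemp | hne
  · have e : (fun τ => traceNorm (ampliation (Fin k) (Λ τ) X)) = fun _ => traceNorm X := by
      funext τ
      congr 1
      exact Subsingleton.elim _ _
    rw [e] at hr
    exact (hr.unique (hasDerivAt_const t _)).le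
  obtain ⟨c, hc, h1, h2⟩ := exists_pos_smul_one_posSemidef hX
  have hp := negativityProbe_posSemidef h1 h2
  set N : ℝ := (negativityProbe X c).trace.re with hN
  have hNtr : (negativityProbe X c).trace = N :=
    Complex.ext rfl (Complex.le_def.1 hp.trace_nonneg).2.symm
  have hNpos : 0 < N := by
    have a1 := (Complex.le_def.1 h1.trace_nonneg).1
    have a2 : ((c : ℂ) • 1 + X).trace.re + ((c : ℂ) • 1 - X).trace.re =
        2 * c * (Fintype.card (Fin d × Fin k)) := by
      rw [← Complex.add_re, ← trace_add, add_add_sub_cancel, trace_add, trace_smul, trace_one]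
      norm_num
      ring
    have a3 : (0 : ℝ) < 2 * c * (Fintype.card (Fin d × Fin k)) := by
      have : 0 < Fintype.card (Fin d × Fin k) := Fintype.card_pos
      positivity
    rw [hN, trace_negativityProbe, Complex.add_re]
    simp only [Complex.zero_re, Complex.mul_re, Complex.re_ofNat, Complex.im_ofNat, zero_mul,
      sub_zero] at a1 ⊢
    linarith
  have hstate : IsState (((N⁻¹ : ℝ) : ℂ) • negativityProbe X c) := by
    refine ⟨hp.smul ?_, ?_⟩
    · rw [Complex.zero_le_real]
      positivity
    · rw [trace_smul, hNtr, smul_eq_mul, ← Complex.ofReal_mul, inv_mul_cancel₀ hNpos.ne',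
        Complex.ofReal_one]
  set K : ℝ := 3 * ((c : ℂ) • (1 : Op (Fin d × Fin k))).trace.re
  have hder : HasDerivAt (fun τ : ℝ => negativityABC
      (ampliation (Fin (k * 2) × Fin 2) (Λ τ) (((N⁻¹ : ℝ) : ℂ) • negativityProbe X c)))
      (N⁻¹ * r / 2) t := by
    have h3 := (((hr.add_const K).const_mul N⁻¹).sub_const 1).div_const 2
    refine h3.congr_of_eventuallyEq ?_
    filter_upwards [Ioi_mem_nhds ht] with τ hτ
    rw [ampliation_smul]
    have e : partialTranspose (Matrix.reindex (Equiv.prodAssoc _ _ _).symm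
        (Equiv.prodAssoc _ _ _).symm
        (((N⁻¹ : ℝ) : ℂ) • ampliation _ (Λ τ) (negativityProbe X c))) =
        ((N⁻¹ : ℝ) : ℂ) • partialTranspose (Matrix.reindex (Equiv.prodAssoc _ _ _).symm
        (Equiv.prodAssoc _ _ _).symm (ampliation _ (Λ τ) (negativityProbe X c))) := rfl
    rw [negativityABC, negativity, e, traceNorm_smul_of_nonneg (by positivity),
      traceNorm_partialTranspose_negativityProbe (hΛ.cptp τ (le_of_lt hτ)) X hc.le]
  have h4 := h _ _ _ hstate t ht _ hder
  have h5 : 0 < N⁻¹ / 2 := by positivity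
  nlinarith

end Negativity

/-! ### Choi matrices and limits of quantum operations. -/

section CompletelyPositive

theorem Matrix.PosSemidef.apply_eq_zero {n : Type} [Fintype n] [DecidableEq n] {A : Op n}
    (hA : A.PosSemidef) {p : n} (hp : A p p = 0) (q : n) : A p q = 0 := by
  obtain ⟨R, rfl⟩ := CStarAlgebra.nonneg_iff_eq_star_mul_self.1 (nonneg_iff_posSemidef.2 hA)
  have h : ∀ l, R l p = 0 := by
    have h1 : (star R * R) p p = ((∑ l, Complex.normSq (R l p) : ℝ) : ℂ) := by
      simp [mul_apply, star_eq_conjTranspose, conjTranspose_apply, Complex.normSq_eq_conj_mul_self]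
    rw [h1, Complex.ofReal_eq_zero, Finset.sum_eq_zero_iff_of_nonneg
      fun _ _ => Complex.normSq_nonneg _] at hp
    intro l
    simpa using hp l (Finset.mem_univ _)
  simp [mul_apply, star_eq_conjTranspose, conjTranspose_apply, h]

theorem Matrix.PosSemidef.norm_apply_le {n : Type} [Fintype n] [DecidableEq n] {A : Op n}
    (hA : A.PosSemidef) (p q : n) : ‖A p q‖ ≤ A.trace.re := by
  obtain ⟨R, rfl⟩ := CStarAlgebra.nonneg_iff_eq_star_mul_self.1 (nonneg_iff_posSemidef.2 hA)
  have htr : (star R * R).trace.re = ∑ i, ∑ l, ‖R l i‖ ^ 2 := by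
    simp only [trace, diag, mul_apply, star_eq_conjTranspose, conjTranspose_apply, Complex.re_sum]
    refine Finset.sum_congr rfl fun i _ => Finset.sum_congr rfl fun l _ => ?_
    rw [← Complex.normSq_eq_norm_sq]
    simp [Complex.normSq_apply]
  have hcol : ∀ i, ∑ l, ‖R l i‖ ^ 2 ≤ (star R * R).trace.re := fun i => by
    rw [htr]
    exact Finset.single_le_sum (f := fun i => ∑ l, ‖R l i‖ ^ 2)
      (fun i _ => Finset.sum_nonneg fun l _ => by positivity) (Finset.mem_univ i)
  calc ‖(star R * R) p q‖ ≤ ∑ l, ‖R l p‖ * ‖R l q‖ := by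
        simp only [mul_apply, star_eq_conjTranspose, conjTranspose_apply]
        refine (norm_sum_le _ _).trans_eq (Finset.sum_congr rfl fun l _ => ?_)
        rw [norm_mul, norm_star]
    _ ≤ ∑ l, (‖R l p‖ ^ 2 + ‖R l q‖ ^ 2) / 2 := by
        gcongr with l
        nlinarith [sq_nonneg (‖R l p‖ - ‖R l q‖)]
    _ = ((∑ l, ‖R l p‖ ^ 2) + ∑ l, ‖R l q‖ ^ 2) / 2 := by
        rw [← Finset.sum_div, Finset.sum_add_distrib]
    _ ≤ (star R * R).trace.re := by linarith [hcol p, hcol q]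

theorem IsCompletelyPositive.comp {n : Type} [Fintype n] {Φ Ψ : Op n →ₗ[ℂ] Op n} (hΦ : IsCompletelyPositive Φ)
    (hΨ : IsCompletelyPositive Ψ) : IsCompletelyPositive (Φ ∘ₗ Ψ) := fun k X hX =>
  hΦ k _ (hΨ k X hX)

variable {n : Type} [Fintype n] [DecidableEq n]

/-- The unnormalized maximally entangled operator. -/
def maxEntangledOp (n : Type) [DecidableEq n] : Op (n × n) :=
  Matrix.of fun p q => if p.1 = p.2 ∧ q.1 = q.2 then 1 else 0

theorem maxEntangledOp_posSemidef : (maxEntangledOp n).PosSemidef := by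
  have h : maxEntangledOp n = vecMulVec (fun p : n × n => if p.1 = p.2 then 1 else 0)
      (star fun p : n × n => if p.1 = p.2 then 1 else 0) := by
    ext p q
    by_cases hp : p.1 = p.2 <;> by_cases hq : q.1 = q.2 <;>
      simp [maxEntangledOp, vecMulVec_apply, hp, hq]
  rw [h]
  exact posSemidef_vecMulVec_self_star _

/-- The Choi matrix of a linear map. -/
def choi {n : Type} [DecidableEq n] (Φ : Op n →ₗ[ℂ] Op n) : Op (n × n) := ampliation n Φ (maxEntangledOp n)

theorem choi_apply {n : Type} [DecidableEq n] (Φ : Op n →ₗ[ℂ] Op n) (p q : n × n) :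
    choi Φ p q = Φ (single p.2 q.2 1) p.1 q.1 := by
  have : (Matrix.of fun i j => maxEntangledOp n (i, p.2) (j, q.2)) = single p.2 q.2 1 := by
    ext i j
    simp [maxEntangledOp, single_apply, eq_comm]
  rw [choi, ampliation_apply, this]

theorem IsCompletelyPositive.choi_posSemidef {Φ : Op n →ₗ[ℂ] Op n}
    (hΦ : IsCompletelyPositive Φ) : (choi Φ).PosSemidef :=
  hΦ.ampliation_posSemidef maxEntangledOp_posSemidef

/-- The linear map with a given Choi matrix. -/
def ofChoi {n : Type} [Fintype n] (C : Op (n × n)) : Op n →ₗ[ℂ] Op n where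
  toFun Y := Matrix.of fun i j => ∑ k, ∑ l, Y k l * C (i, k) (j, l)
  map_add' X Y := by
    ext i j
    simp [add_mul, Finset.sum_add_distrib]
  map_smul' c Y := by
    ext i j
    simp [mul_assoc, Finset.mul_sum]

theorem ofChoi_apply {n : Type} [Fintype n] (C : Op (n × n)) (Y : Op n) (i j : n) :
    ofChoi C Y i j = ∑ k, ∑ l, Y k l * C (i, k) (j, l) := rfl

theorem ofChoi_choi (Φ : Op n →ₗ[ℂ] Op n) : ofChoi (choi Φ) = Φ := by
  ext1 Y
  ext i j
  rw [ofChoi_apply]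
  conv_rhs => rw [matrix_eq_sum_single Y]
  simp only [choi_apply, map_sum, Matrix.sum_apply]
  refine Finset.sum_congr rfl fun k _ => Finset.sum_congr rfl fun l _ => ?_
  have : single k l (Y k l) = Y k l • (single k l 1 : Op n) := by simp [smul_single]
  rw [this, map_smul, Matrix.smul_apply, smul_eq_mul]

/-- This is `Wᴴ M W`, where `W` stacks one identity matrix for each index in `κ`. -/
theorem Matrix.PosSemidef.sum_blocks {κ ι : Type} [Fintype κ] [Fintype ι] [DecidableEq ι]
    {M : Op (κ × ι)} (hM : M.PosSemidef) :
    (Matrix.of fun p q => ∑ k, ∑ l, M (k, p) (l, q) : Op ι).PosSemidef := by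
  set W : Matrix (κ × ι) ι ℂ := Matrix.of fun p q => if p.2 = q then 1 else 0
  have h := hM.conjTranspose_mul_mul_same W
  convert h using 1
  ext p q
  simp only [W, of_apply, mul_apply, conjTranspose_apply, Fintype.sum_prod_type, apply_ite star,
    star_one, star_zero, ite_mul, one_mul, zero_mul, mul_ite, mul_one, mul_zero,
    Finset.sum_ite_eq', Finset.mem_univ, if_true]
  rw [Finset.sum_comm]

/-- The ampliated output is a block sum of the submatrix of `C ⊗ X` on which the input indices of
the two factors agree. -/
theorem isCompletelyPositive_ofChoi {C : Op (n × n)} (hC : C.PosSemidef) :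
    IsCompletelyPositive (ofChoi C) := by
  intro m X hX
  have h := ((hC.kronecker hX).submatrix
    fun p : n × (n × Fin m) => ((p.2.1, p.1), (p.1, p.2.2))).sum_blocks
  convert h using 1
  ext p q
  rw [ampliation_apply, ofChoi_apply]
  simp [mul_comm]

/-- Conjugation `Y ↦ A Y A†`. -/
def conjugation (A : Op n) : Op n →ₗ[ℂ] Op n where
  toFun Y := A * Y * Aᴴ
  map_add' X Y := by rw [mul_add, add_mul]
  map_smul' c Y := by simp

theorem conjugation_apply (A Y : Op n) : conjugation A Y = A * Y * Aᴴ := rfl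

theorem isCompletelyPositive_conjugation (A : Op n) : IsCompletelyPositive (conjugation A) := by
  intro m X hX
  have h := hX.mul_mul_conjTranspose_same (kroneckerMap (· * ·) A (1 : Op (Fin m)))
  convert h using 1
  ext ⟨i, a⟩ ⟨j, b⟩
  simp [ampliation_apply, conjugation_apply, mul_apply, conjTranspose_apply,
    Fintype.sum_prod_type, one_apply, apply_ite star]

/-- Trace preservation, Hermiticity preservation and trace norm contraction are closed conditions,
and together they characterize quantum operations. -/
theorem IsCPTP.of_tendsto {V : ℕ → Op n →ₗ[ℂ] Op n} (hV : ∀ k, IsCPTP (V k))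
    {E : Op n →ₗ[ℂ] Op n} (h : ∀ Y, Tendsto (fun k => V k Y) atTop (𝓝 (E Y))) : IsCPTP E := by
  refine IsCPTP.of_traceNorm_ampliation_le (fun X => ?_) (fun X hX => ?_) fun m X hX => ?_
  · have h1 : Tendsto (fun k => (V k X).trace) atTop (𝓝 (E X).trace) :=
      ((continuous_id.matrix_trace).tendsto (E X)).comp (h X)
    simp only [(hV _).trace_map] at h1
    exact (tendsto_nhds_unique h1 tendsto_const_nhds)
  · have h1 : Tendsto (fun k => (V k X)ᴴ) atTop (𝓝 (E X)ᴴ) :=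
      ((continuous_id.matrix_conjTranspose).tendsto (E X)).comp (h X)
    simp only [((hV _).1.map_isHermitian hX).eq] at h1
    exact tendsto_nhds_unique h1 (h X)
  · have h1 : Tendsto (fun k => ampliation (Fin m) (V k) X) atTop
        (𝓝 (ampliation (Fin m) E X)) := by
      refine tendsto_pi_nhds.2 fun p => tendsto_pi_nhds.2 fun q => ?_
      exact (tendsto_pi_nhds.1 (tendsto_pi_nhds.1 (h _) p.1)) q.1
    exact le_of_tendsto' ((continuous_traceNorm.tendsto _).comp h1)
      fun k => (hV k).traceNorm_ampliation_le hX

/-- The set of quantum operations is sequentially compact. -/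
theorem IsCPTP.exists_tendsto_subseq {V : ℕ → Op n →ₗ[ℂ] Op n} (hV : ∀ k, IsCPTP (V k)) :
    ∃ E : Op n →ₗ[ℂ] Op n, IsCPTP E ∧ ∃ φ : ℕ → ℕ, StrictMono φ ∧
      ∀ (Y : ℕ → Op n) (Y₀ : Op n), Tendsto Y atTop (𝓝 Y₀) →
        Tendsto (fun k => V (φ k) (Y k)) atTop (𝓝 (E Y₀)) := by
  set M : ℝ := (maxEntangledOp n).trace.re
  have hb : ∀ k, (fun x : (n × n) × (n × n) => choi (V k) x.1 x.2) ∈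
      Set.pi univ fun _ => Metric.closedBall (0 : ℂ) M := by
    intro k x _
    rw [mem_closedBall_zero_iff]
    refine ((hV k).1.choi_posSemidef.norm_apply_le _ _).trans_eq ?_
    rw [choi, trace_ampliation (hV k).trace_map]
  obtain ⟨c, -, φ, hφ, hc⟩ :=
    (isCompact_univ_pi fun _ => isCompact_closedBall (0 : ℂ) M).tendsto_subseq hb
  set C : Op (n × n) := Matrix.of fun p q => c (p, q)
  -- Convergence of Choi entries gives convergence jointly in the map and its argument; moving
  -- arguments are needed for kernel vectors and for the fixed range.
  have key : ∀ (Y : ℕ → Op n) (Y₀ : Op n), Tendsto Y atTop (𝓝 Y₀) →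
      Tendsto (fun k => V (φ k) (Y k)) atTop (𝓝 (ofChoi C Y₀)) := by
    intro Y Y₀ hY
    refine tendsto_pi_nhds.2 fun i => tendsto_pi_nhds.2 fun j => ?_
    have e : ∀ k, V (φ k) (Y k) i j =
        ∑ p, ∑ q, Y k p q * choi (V (φ k)) (i, p) (j, q) := fun k => by
      rw [← ofChoi_apply, ofChoi_choi]
    simp only [e]
    refine tendsto_finsetSum _ fun p _ => tendsto_finsetSum _ fun q _ => ?_
    refine Tendsto.mul ?_ ?_
    · exact tendsto_pi_nhds.1 (tendsto_pi_nhds.1 hY p) q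
    · exact tendsto_pi_nhds.1 hc ((i, p), (j, q))
  exact ⟨ofChoi C, IsCPTP.of_tendsto (fun k => hV (φ k)) fun Y => key _ _ tendsto_const_nhds,
    φ, hφ, key⟩

/-- A limit of non-injective maps is not injective. -/
theorem not_injective_of_tendsto {V : ℕ → Op n →ₗ[ℂ] Op n} {E : Op n →ₗ[ℂ] Op n}
    (hV : ∀ k, ¬ Function.Injective (V k)) {φ : ℕ → ℕ}
    (h : ∀ (Y : ℕ → Op n) (Y₀ : Op n), Tendsto Y atTop (𝓝 Y₀) →
        Tendsto (fun k => V (φ k) (Y k)) atTop (𝓝 (E Y₀))) : ¬ Function.Injective E := by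
  have h1 : ∀ k, ∃ Y : Op n, ‖Y‖ = 1 ∧ V k Y = 0 := by
    intro k
    have h2 := hV k
    rw [← LinearMap.ker_eq_bot, ← ne_eq, Submodule.ne_bot_iff] at h2
    obtain ⟨Z, hZ, hZ0⟩ := h2
    refine ⟨((‖Z‖⁻¹ : ℝ) : ℂ) • Z, ?_, ?_⟩
    · rw [norm_smul, Complex.norm_real, norm_inv, norm_norm, inv_mul_cancel₀]
      exact norm_ne_zero_iff.2 hZ0
    · rw [map_smul, LinearMap.mem_ker.1 hZ, smul_zero]
  choose Y hY1 hY0 using h1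
  have : ProperSpace (Op n) := FiniteDimensional.proper ℂ _
  obtain ⟨Y₀, hY₀, ψ, hψ, hlim⟩ := (isCompact_sphere (0 : Op n) 1).tendsto_subseq
    (x := fun k => Y (φ k)) fun k => by simp [hY1]
  -- `h` expects a full convergent sequence, so the indices missed by `ψ` are filled with the limit.
  have h3 : ∃ Z : ℕ → Op n, Tendsto Z atTop (𝓝 Y₀) ∧ ∀ k, Z (ψ k) = Y (φ (ψ k)) := by
    classical
    refine ⟨fun m => if m ∈ range ψ then Y (φ m) else Y₀, ?_, fun k => if_pos ⟨k, rfl⟩⟩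
    rw [tendsto_def] at hlim ⊢
    intro s hs
    have := hlim s hs
    rw [mem_atTop_sets] at this ⊢
    obtain ⟨N, hN⟩ := this
    refine ⟨ψ N, fun m hm => ?_⟩
    rw [mem_preimage]
    split_ifs with hr
    · obtain ⟨k, rfl⟩ := hr
      exact hN k (hψ.le_iff_le.1 hm)
    · exact mem_of_mem_nhds hs
  obtain ⟨Z, hZ, hZY⟩ := h3
  have h4 := (h Z Y₀ hZ).comp hψ.tendsto_atTop
  have h5 : ((fun k => V (φ k) (Z k)) ∘ ψ) = fun _ => 0 := by
    funext k
    simp [hZY, hY0]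
  rw [h5] at h4
  have h6 : E Y₀ = 0 := tendsto_nhds_unique h4 tendsto_const_nhds
  intro hinj
  have h7 : Y₀ = 0 := hinj (by rw [h6, map_zero])
  rw [h7] at hY₀
  simp at hY₀

end CompletelyPositive

/-! ### Qubit operators, determinants and pure states in the range of a channel. -/

section Qubit

theorem exists_eq_of_isHermitian_fin_two {A : Op (Fin 2)} (hA : A.IsHermitian) :
    ∃ (a b : ℝ) (z : ℂ), A = !![(a : ℂ), z; star z, (b : ℂ)] := by
  refine ⟨(A 0 0).re, (A 1 1).re, A 0 1, ?_⟩
  have h0 := Complex.conj_eq_iff_re.1 (hA.apply 0 0)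
  have h1 := Complex.conj_eq_iff_re.1 (hA.apply 1 1)
  have h2 := hA.apply 1 0
  ext i j
  fin_cases i <;> fin_cases j <;> simp [h0, h1]
  exact h2.symm

theorem det_hermitian_fin_two (a b : ℝ) (z : ℂ) :
    (!![(a : ℂ), z; star z, (b : ℂ)] : Op (Fin 2)).det = ((a * b - Complex.normSq z : ℝ) : ℂ) := by
  rw [det_fin_two_of]
  have : z * star z = (Complex.normSq z : ℂ) := Complex.mul_conj z
  rw [this]
  push_cast
  ring

/-- A qubit state that is singular, together with all its mixtures with a singular `N`, forces `N`
to be proportional to it. -/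
theorem eq_trace_smul_of_det_eq_zero {P N : Op (Fin 2)} (hP : P.IsHermitian) (hN : N.IsHermitian)
    (hPt : P.trace = 1) (hPd : P.det = 0) (hNd : N.det = 0) (hPN : (P + N).det = 0) :
    N = N.trace • P := by
  obtain ⟨p, q, z, rfl⟩ := exists_eq_of_isHermitian_fin_two hP
  obtain ⟨m, n, w, rfl⟩ := exists_eq_of_isHermitian_fin_two hN
  have hsum : (!![(p : ℂ), z; star z, (q : ℂ)] + !![(m : ℂ), w; star w, (n : ℂ)] : Op (Fin 2)) =
      !![((p + m : ℝ) : ℂ), z + w; star (z + w), ((q + n : ℝ) : ℂ)] := by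
    ext i j
    fin_cases i <;> fin_cases j <;> simp
  rw [hsum, det_hermitian_fin_two, Complex.ofReal_eq_zero, Complex.normSq_apply] at hPN
  rw [det_hermitian_fin_two, Complex.ofReal_eq_zero, Complex.normSq_apply] at hPd hNd
  have hpq : p + q = 1 := by
    have := congrArg Complex.re hPt
    simpa [trace_fin_two] using this
  obtain ⟨zr, zi⟩ := z
  obtain ⟨wr, wi⟩ := w
  simp only [Complex.add_re, Complex.add_im] at hPN hPd hNd
  -- The mixed term of `det (P + N)` vanishes. With Cauchy–Schwarz this gives `(p n - q m)² ≤ 0`,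
  -- and the equality case makes `N` and `P` proportional.
  have hcross : p * n + q * m = 2 * (zr * wr + zi * wi) := by nlinarith
  have h1 : p * n = q * m := by
    have hCS : (zr * wr + zi * wi) ^ 2 ≤ (zr * zr + zi * zi) * (wr * wr + wi * wi) := by
      nlinarith [sq_nonneg (zr * wi - zi * wr)]
    have e : (zr * zr + zi * zi) * (wr * wr + wi * wi) = (p * q) * (m * n) := by
      rw [show zr * zr + zi * zi = p * q by linarith, show wr * wr + wi * wi = m * n by linarith]
    have : (p * n - q * m) ^ 2 ≤ 0 := by nlinarith
    exact sub_eq_zero.1 ((pow_eq_zero_iff two_ne_zero).1 (le_antisymm this (sq_nonneg _)))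
  have hm : m = (m + n) * p := by
    have : q = 1 - p := by linarith
    subst this
    linarith
  have hn : n = (m + n) * q := by
    have : p = 1 - q := by linarith
    subst this
    linarith
  have h2 : (wr - (m + n) * zr) ^ 2 + (wi - (m + n) * zi) ^ 2 = 0 := by
    have e1 : wr * wr + wi * wi = (m + n) ^ 2 * (p * q) := by
      have : m * n = ((m + n) * p) * ((m + n) * q) := by rw [← hm, ← hn]
      nlinarith
    have e2 : zr * zr + zi * zi = p * q := by linarith
    have e3 : 2 * (zr * wr + zi * wi) = (m + n) * (2 * (p * q)) := by
      rw [← hcross]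
      have : p * n + q * m = p * ((m + n) * q) + q * ((m + n) * p) := by rw [← hm, ← hn]
      rw [this]
      ring
    linear_combination e1 + (m + n) ^ 2 * e2 - (m + n) * e3
  have hr : wr = (m + n) * zr := by
    have := sq_nonneg (wi - (m + n) * zi)
    exact sub_eq_zero.1 ((pow_eq_zero_iff two_ne_zero).1 (le_antisymm (by linarith) (sq_nonneg _)))
  have hi : wi = (m + n) * zi := by
    have := sq_nonneg (wr - (m + n) * zr)
    exact sub_eq_zero.1 ((pow_eq_zero_iff two_ne_zero).1 (le_antisymm (by linarith) (sq_nonneg _)))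
  ext i j
  fin_cases i <;> fin_cases j <;>
    simp [trace_fin_two, Complex.ext_iff, hr, hi]
  · exact hm
  · exact hn

/-- A qubit channel whose range contains no invertible Hermitian operator is constant. -/
theorem IsCPTP.eq_trace_smul_of_forall_not_isUnit {L : Op (Fin 2) →ₗ[ℂ] Op (Fin 2)} (hL : IsCPTP L)
    (h : ∀ W : Op (Fin 2), W.IsHermitian → ¬ IsUnit (L W)) :
    ∃ P, IsState P ∧ ∀ Y, L Y = Y.trace • P := by
  have hdet : ∀ W : Op (Fin 2), W.IsHermitian → (L W).det = 0 := fun W hW => by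
    have := h W hW
    rw [isUnit_iff_isUnit_det, isUnit_iff_ne_zero, not_not] at this
    exact this
  set J : Op (Fin 2) := (2⁻¹ : ℂ) • 1
  have hJ : J.PosSemidef := PosSemidef.one.smul (by norm_num [Complex.le_def])
  have hJt : (L J).trace = 1 := by
    rw [hL.trace_map, trace_smul, trace_one]
    norm_num
  have hherm : ∀ W : Op (Fin 2), W.IsHermitian → L W = W.trace • L J := fun W hW => by
    have := eq_trace_smul_of_det_eq_zero (hL.1.map_isHermitian hJ.1) (hL.1.map_isHermitian hW) hJt
      (hdet J hJ.1) (hdet W hW) (by rw [← map_add]; exact hdet _ (hJ.1.add hW))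
    rwa [hL.trace_map] at this
  refine ⟨L J, ⟨hL.1.map_posSemidef hJ, hJt⟩, fun Y => ?_⟩
  obtain ⟨A, B, hA, hB, rfl⟩ := exists_isHermitian_add_smul_I Y
  rw [map_add, map_smul, hherm A hA, hherm B hB, trace_add, trace_smul, add_smul, smul_assoc]

/-- In terms of eigenvalues, `(|λ| + |μ|)² = (λ + μ)² - 2 λ μ + 2 |λ μ|`. -/
theorem sq_traceNorm_fin_two {A : Op (Fin 2)} (hA : A.IsHermitian) :
    traceNorm A ^ 2 = A.trace.re ^ 2 - 2 * A.det.re + 2 * |A.det.re| := by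
  set S := CFC.abs A with hS
  have hSh := (posSemidef_abs A).1
  have hSS : S * S = A * A := by
    rw [hS, CFC.abs_mul_abs, star_eq_conjTranspose, hA.eq]
  have hdet : S.det.re = |A.det.re| := by
    have h1 : S.det = ‖A.det‖ := hA.det_abs
    have h2 : A.det.im = 0 := by
      obtain ⟨a, b, z, rfl⟩ := exists_eq_of_isHermitian_fin_two hA
      rw [det_hermitian_fin_two, Complex.ofReal_im]
    have h3 : A.det = ((A.det.re : ℝ) : ℂ) := Complex.ext rfl h2
    rw [h1, h3, Complex.norm_real, Complex.ofReal_re, Complex.ofReal_re, Real.norm_eq_abs]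
  have hid : ∀ M : Op (Fin 2), M.IsHermitian →
      M.trace.re ^ 2 = (M * M).trace.re + 2 * M.det.re := by
    intro M hM
    obtain ⟨a, b, z, rfl⟩ := exists_eq_of_isHermitian_fin_two hM
    rw [det_hermitian_fin_two, Complex.ofReal_re, Complex.normSq_apply]
    simp [trace_fin_two]
    ring
  have e1 := hid S hSh
  have e2 := hid A hA
  rw [hSS, hdet] at e1
  rw [traceNorm_eq_trace_abs, ← hS]
  linarith

/-- For qubits, contraction of the trace norm raises negative determinants. -/
theorem det_le_det_of_traceNorm_le {A B : Op (Fin 2)} (hA : A.IsHermitian) (hB : B.IsHermitian)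
    (htr : A.trace = B.trace) (h : traceNorm A ≤ traceNorm B) (hdB : B.det.re ≤ 0) :
    B.det.re ≤ A.det.re := by
  rcases le_or_gt 0 A.det.re with h0 | h0
  · linarith
  · have h1 : traceNorm A ^ 2 ≤ traceNorm B ^ 2 := by
      have := traceNorm_nonneg A
      gcongr
    rw [sq_traceNorm_fin_two hA, sq_traceNorm_fin_two hB, abs_of_neg h0, abs_of_nonpos hdB,
      htr] at h1
    linarith

theorem exists_vecMulVec_of_det_eq_zero {P : Op (Fin 2)} (hP : P.IsHermitian) (ht : P.trace = 1)
    (hd : P.det = 0) : ∃ x : Fin 2 → ℂ, P = vecMulVec x (star x) := by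
  obtain ⟨a, b, z, rfl⟩ := exists_eq_of_isHermitian_fin_two hP
  rw [det_hermitian_fin_two, Complex.ofReal_eq_zero] at hd
  have hab : a + b = 1 := by
    have := congrArg Complex.re ht
    simpa [trace_fin_two] using this
  have hz := Complex.normSq_nonneg z
  by_cases ha : a = 0
  · have hz0 : z = 0 := by
      rw [← Complex.normSq_eq_zero]
      nlinarith
    have hb : b = 1 := by linarith
    refine ⟨![0, 1], ?_⟩
    ext i j
    fin_cases i <;> fin_cases j <;> simp [vecMulVec_apply, ha, hz0, hb]
  · have ha0 : 0 < a := by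
      have : 0 ≤ a := by nlinarith
      exact lt_of_le_of_ne this (Ne.symm ha)
    have hs : (Real.sqrt a : ℂ) * (Real.sqrt a : ℂ) = a := by
      rw [← Complex.ofReal_mul, Real.mul_self_sqrt ha0.le]
    have hs0 : (Real.sqrt a : ℂ) ≠ 0 := by
      rw [Complex.ofReal_ne_zero]
      exact (Real.sqrt_pos.2 ha0).ne'
    refine ⟨![(Real.sqrt a : ℂ), star z / Real.sqrt a], ?_⟩
    ext i j
    fin_cases i <;> fin_cases j <;> simp [vecMulVec_apply]
    · exact hs.symm
    · field_simp
    · field_simp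
    · rw [div_mul_div_comm, hs, mul_comm, Complex.mul_conj, eq_div_iff (by exact_mod_cast ha),
        ← Complex.ofReal_mul]
      congr 1
      linarith

/-- The discriminant could vanish only for `b = c = 0`, when the quadratic is negative away from 0;
the point `ε` excludes this. -/
theorem exists_roots_of_quadratic {a b c : ℝ} (ha : a < 0) (hc : 0 ≤ c)
    (h : ∃ ε : ℝ, ε ≠ 0 ∧ 0 ≤ a * ε ^ 2 + b * ε + c) :
    ∃ u v : ℝ, u ≠ v ∧ a * u ^ 2 + b * u + c = 0 ∧ a * v ^ 2 + b * v + c = 0 := by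
  have hD : 0 < b ^ 2 - 4 * a * c := by
    have h0 : 0 ≤ -a * c := by nlinarith
    rcases lt_or_eq_of_le h0 with h1 | h1
    · nlinarith [sq_nonneg b]
    · have hc0 : c = 0 := by nlinarith
      obtain ⟨ε, hε, hp⟩ := h
      have hb : b ≠ 0 := by
        rintro rfl
        have : 0 < ε ^ 2 := by positivity
        nlinarith
      rw [hc0]
      have : 0 < b ^ 2 := by positivity
      linarith
  set s := Real.sqrt (b ^ 2 - 4 * a * c)
  have hs : s * s = b ^ 2 - 4 * a * c := Real.mul_self_sqrt hD.le
  have hs0 : 0 < s := Real.sqrt_pos.2 hD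
  have ha0 : a ≠ 0 := ha.ne
  refine ⟨(-b + s) / (2 * a), (-b - s) / (2 * a), ?_, ?_, ?_⟩
  · intro h
    rw [div_left_inj' (by simpa using ha0)] at h
    linarith
  · field_simp
    linear_combination hs
  · field_simp
    linear_combination hs

theorem mul_single_mul_conjTranspose_apply {n : Type} [Fintype n] [DecidableEq n] (G : Op n)
    (i j a b : n) : (G * (single i j 1 : Op n) * Gᴴ : Op n) a b = G a i * star (G b j) := by
  rw [mul_assoc, mul_apply]
  simp [mul_apply, single_apply, conjTranspose_apply, ite_and]

/-- A non-constant qubit channel has two distinct pure states in the image of the Hermitian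
operators of unit trace; `G` is the matrix with these state vectors as columns. -/
theorem IsCPTP.exists_pure_states {L : Op (Fin 2) →ₗ[ℂ] Op (Fin 2)} (hL : IsCPTP L)
    (h : ¬ ∃ P, IsState P ∧ ∀ Y, L Y = Y.trace • P) :
    ∃ G : Op (Fin 2), IsUnit G.det ∧ ∃ W : Fin 2 → Op (Fin 2), ∀ i,
      (W i).IsHermitian ∧ (W i).trace = 1 ∧ L (W i) = G * single i i 1 * Gᴴ := by
  obtain ⟨J, hJdef⟩ : ∃ J : Op (Fin 2), J = (2⁻¹ : ℂ) • 1 := ⟨_, rfl⟩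
  have hJ : J.PosSemidef := hJdef ▸ PosSemidef.one.smul (by norm_num [Complex.le_def])
  have hJt : J.trace = 1 := by
    rw [hJdef, trace_smul, trace_one]
    norm_num
  have hLJ := hL.1.map_posSemidef hJ
  have h1 : ∃ W₀ : Op (Fin 2), W₀.IsHermitian ∧ L W₀ ≠ W₀.trace • L J := by
    by_contra! hcon
    refine h ⟨L J, ⟨hLJ, by rw [hL.trace_map, hJt]⟩, fun Y => ?_⟩
    obtain ⟨A, B, hA, hB, rfl⟩ := exists_isHermitian_add_smul_I Y
    rw [map_add, map_smul, hcon A hA, hcon B hB, trace_add, trace_smul, add_smul, smul_assoc]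
  obtain ⟨W₀, hW₀, hne⟩ := h1
  have hreal : ∀ M : Op (Fin 2), M.IsHermitian → M.trace = (M.trace.re : ℂ) := by
    intro M hM
    obtain ⟨a, b, z, rfl⟩ := exists_eq_of_isHermitian_fin_two hM
    simp [trace_fin_two]
  -- On the unit-trace line `J + u K`, the determinant of the image is a strictly concave quadratic
  -- in `u`. Its two roots give pure images, although `J + u K` itself may fail to be positive
  -- there.
  set K := W₀ - W₀.trace • J with hK
  have hKh : K.IsHermitian := by
    refine hW₀.sub ?_
    rw [hreal W₀ hW₀, IsHermitian, conjTranspose_smul, hJ.1.eq]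
    simp
  have hKt : K.trace = 0 := by
    rw [hK, trace_sub, trace_smul, hJt, smul_eq_mul, mul_one, sub_self]
  set N := L K with hN
  have hN0 : N ≠ 0 := by
    rw [hN, hK, map_sub, map_smul]
    exact sub_ne_zero.2 hne
  have hNh : N.IsHermitian := hL.1.map_isHermitian hKh
  have hNt : N.trace = 0 := by rw [hN, hL.trace_map, hKt]
  obtain ⟨a, b, z, hR⟩ := exists_eq_of_isHermitian_fin_two hLJ.1
  obtain ⟨m, n, w, hNe⟩ := exists_eq_of_isHermitian_fin_two hNh
  have hn : n = -m := by
    rw [hNe, trace_fin_two] at hNt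
    have := congrArg Complex.re hNt
    simp at this
    linarith
  have hline : ∀ u : ℝ, (L (J + (u : ℂ) • K)).det =
      (((m * n - Complex.normSq w) * u ^ 2 +
        (a * n + b * m - 2 * (z.re * w.re + z.im * w.im)) * u +
        (a * b - Complex.normSq z) : ℝ) : ℂ) := by
    intro u
    have e : L (J + (u : ℂ) • K) =
        !![((a + u * m : ℝ) : ℂ), z + u * w; star (z + u * w), ((b + u * n : ℝ) : ℂ)] := by
      rw [map_add, map_smul, ← hN, hR, hNe]
      ext i j
      fin_cases i <;> fin_cases j <;> simp
    rw [e, det_hermitian_fin_two, Complex.ofReal_inj]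
    simp only [Complex.normSq_apply, Complex.add_re, Complex.add_im, Complex.re_ofReal_mul,
      Complex.im_ofReal_mul]
    ring
  have hneg : m * n - Complex.normSq w < 0 := by
    rw [hn]
    by_contra hcon
    have h2 := Complex.normSq_nonneg w
    have hm0 : m = 0 := by nlinarith
    have hw0 : w = 0 := by
      rw [← Complex.normSq_eq_zero]
      nlinarith
    apply hN0
    rw [hNe, hn, hm0, hw0]
    ext i j
    fin_cases i <;> fin_cases j <;> simp
  have hdet0 : ∀ u : ℝ, (J + (u : ℂ) • K).PosSemidef → 0 ≤ (m * n - Complex.normSq w) * u ^ 2 +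
        (a * n + b * m - 2 * (z.re * w.re + z.im * w.im)) * u +
        (a * b - Complex.normSq z) := by
    intro u hu
    have h2 := (hL.1.map_posSemidef hu).det_nonneg
    rw [hline, Complex.zero_le_real] at h2
    exact h2
  obtain ⟨c, hc, hcp, -⟩ := exists_pos_smul_one_posSemidef hKh
  -- As `J` is half the identity, `J + K / (2 c)` is a positive multiple of `c 1 + K ≥ 0`, a second
  -- point with nonnegative determinant.
  have hquad := exists_roots_of_quadratic hneg (by simpa using hdet0 0 (by simpa using hJ))
    ⟨(2 * c)⁻¹, by positivity, hdet0 _ (by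
      have e : J + (((2 * c)⁻¹ : ℝ) : ℂ) • K = (((2 * c)⁻¹ : ℝ) : ℂ) • ((c : ℂ) • 1 + K) := by
        rw [smul_add, smul_smul, ← Complex.ofReal_mul,
          show (2 * c)⁻¹ * c = 2⁻¹ by field_simp]
        simp [hJdef]
      rw [e]
      exact hcp.smul (by rw [Complex.zero_le_real]; positivity))⟩
  obtain ⟨u, v, huv, hu, hv⟩ := hquad
  have hWh : ∀ u : ℝ, (J + (u : ℂ) • K).IsHermitian := fun u =>
    hJ.1.add (by simp [IsHermitian, conjTranspose_smul, hKh.eq])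
  have hWt : ∀ u : ℝ, (J + (u : ℂ) • K).trace = 1 := fun u => by
    rw [trace_add, trace_smul, hJt, hKt, smul_zero, add_zero]
  obtain ⟨x, hx⟩ := exists_vecMulVec_of_det_eq_zero (hL.1.map_isHermitian (hWh u))
    (by rw [hL.trace_map, hWt]) (by rw [hline, hu, Complex.ofReal_zero])
  obtain ⟨y, hy⟩ := exists_vecMulVec_of_det_eq_zero (hL.1.map_isHermitian (hWh v))
    (by rw [hL.trace_map, hWt]) (by rw [hline, hv, Complex.ofReal_zero])
  refine ⟨!![x 0, y 0; x 1, y 1], ?_, ![J + (u : ℂ) • K, J + (v : ℂ) • K], ?_⟩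
  · rw [isUnit_iff_ne_zero, det_fin_two_of]
    intro hdet
    -- Parallel vectors would make this difference singular, but `N` is traceless, Hermitian and
    -- nonzero, so its determinant is negative.
    have e1 : vecMulVec x (star x) - vecMulVec y (star y) = ((u - v : ℝ) : ℂ) • N := by
      rw [← hx, ← hy, ← map_sub, hN, ← map_smul]
      congr 1
      push_cast
      module
    have e2 := congrArg det e1
    have e3 : (vecMulVec x (star x) - vecMulVec y (star y)).det =
        -((x 0 * y 1 - y 0 * x 1) * star (x 0 * y 1 - y 0 * x 1)) := by
      rw [det_fin_two]
      simp [vecMulVec_apply]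
      ring
    rw [e3, hdet, zero_mul, neg_zero, det_smul, Fintype.card_fin, hNe,
      det_hermitian_fin_two] at e2
    have h3 : ((u - v : ℝ) : ℂ) ≠ 0 := by
      rw [Complex.ofReal_ne_zero]
      exact sub_ne_zero.2 huv
    have h4 : ((m * n - Complex.normSq w : ℝ) : ℂ) ≠ 0 := by
      rw [Complex.ofReal_ne_zero]
      exact hneg.ne
    exact mul_ne_zero (pow_ne_zero 2 h3) h4 e2.symm
  · intro i
    fin_cases i
    · refine ⟨hWh u, hWt u, ?_⟩
      change L (J + (u : ℂ) • K) = _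
      rw [hx]
      ext i j
      rw [mul_single_mul_conjTranspose_apply]
      fin_cases i <;> fin_cases j <;> simp [vecMulVec_apply]
    · refine ⟨hWh v, hWt v, ?_⟩
      change L (J + (v : ℂ) • K) = _
      rw [hy]
      ext i j
      rw [mul_single_mul_conjTranspose_apply]
      fin_cases i <;> fin_cases j <;> simp [vecMulVec_apply]

end Qubit

/-! ### The Alberti–Uhlmann theorem for two pure qubit states. -/

section Qubit

theorem trace_mul_conj_re {n : Type} [Fintype n] {A B : Op n} (hA : A.IsHermitian)
    (hB : B.IsHermitian) : (A * B).trace = ((A * B).trace.re : ℂ) := by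
  have h : star (A * B).trace = (A * B).trace := by
    rw [← trace_conjTranspose, conjTranspose_mul, hA.eq, hB.eq, trace_mul_comm]
  exact (Complex.conj_eq_iff_re.1 h).symm

theorem det_eq_re {A : Op (Fin 2)} (hA : A.IsHermitian) : A.det = (A.det.re : ℂ) := by
  obtain ⟨a, b, z, rfl⟩ := exists_eq_of_isHermitian_fin_two hA
  rw [det_hermitian_fin_two, Complex.ofReal_re]

/-- For invertible `A` this is Cayley–Hamilton for `A * B` with a factor `A` cancelled; as a
polynomial identity it holds for all `A`. -/
theorem mul_mul_add_det_smul_adjugate (A B : Op (Fin 2)) :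
    B * A * B + B.det • A.adjugate = (A * B).trace • B := by
  ext i j
  fin_cases i <;> fin_cases j <;>
    simp [mul_apply, adjugate_fin_two, det_fin_two, trace_fin_two] <;> ring

theorem inv_conjugation_single {n : Type} [Fintype n] [DecidableEq n] {G : Op n}
    (hG : IsUnit G.det) (Y : Op n) : conjugation G⁻¹ (G * Y * Gᴴ) = Y := by
  rw [conjugation_apply, conjTranspose_nonsing_inv]
  have hG' : IsUnit Gᴴ.det := by
    rw [det_conjTranspose]
    exact hG.star
  calc G⁻¹ * (G * Y * Gᴴ) * Gᴴ⁻¹ = (G⁻¹ * G) * Y * (Gᴴ * Gᴴ⁻¹) := by simp only [mul_assoc]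
    _ = Y := by rw [nonsing_inv_mul _ hG, mul_nonsing_inv _ hG', one_mul, mul_one]

theorem conjugation_inv_conjugation {n : Type} [Fintype n] [DecidableEq n] {G : Op n}
    (hG : IsUnit G.det) (Y : Op n) : G * conjugation G⁻¹ Y * Gᴴ = Y := by
  rw [conjugation_apply, conjTranspose_nonsing_inv]
  have hG' : IsUnit Gᴴ.det := by
    rw [det_conjTranspose]
    exact hG.star
  calc G * (G⁻¹ * Y * Gᴴ⁻¹) * Gᴴ = (G * G⁻¹) * Y * (Gᴴ⁻¹ * Gᴴ) := by simp only [mul_assoc]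
    _ = Y := by rw [mul_nonsing_inv _ hG, nonsing_inv_mul _ hG', one_mul, mul_one]

theorem ofChoi_single {n : Type} [Fintype n] [DecidableEq n] (C : Op (n × n)) (k l i j : n) :
    ofChoi C (single k l 1) i j = C (i, k) (j, l) := by
  rw [ofChoi_apply]
  simp [single_apply, ite_and]

/-- The trace norm criterion of Alberti and Uhlmann for transforming a pair of pure qubit states
into a pair of mixed ones, in terms of the fidelity and for invertible targets. -/
theorem exists_isCPTP_of_fidelity {G A B : Op (Fin 2)} (hG : IsUnit G.det)
    (hG0 : (Gᴴ * G) 0 0 = 1) (hG1 : (Gᴴ * G) 1 1 = 1) (hA : IsState A) (hB : IsState B)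
    (hAd : 0 < A.det.re) (hBd : 0 < B.det.re)
    (hF : Complex.normSq ((Gᴴ * G) 1 0) ≤
      (A * B).trace.re + 2 * Real.sqrt (A.det.re * B.det.re)) :
    ∃ T : Op (Fin 2) →ₗ[ℂ] Op (Fin 2), IsCPTP T ∧ T (G * single 0 0 1 * Gᴴ) = A ∧
      T (G * single 1 1 1 * Gᴴ) = B := by
  obtain ⟨hAp, hAt⟩ := hA
  obtain ⟨hBp, hBt⟩ := hB
  set a := A.det.re
  set b := B.det.re
  have hda : A.det = (a : ℂ) := det_eq_re hAp.1
  have hdb : B.det = (b : ℂ) := det_eq_re hBp.1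
  set δ := Real.sqrt (a * b)
  have hδ : δ * δ = a * b := Real.mul_self_sqrt (by positivity)
  have hδ0 : 0 < δ := Real.sqrt_pos.2 (by positivity)
  set τ := (A * B).trace.re
  have hτ : (A * B).trace = (τ : ℂ) := trace_mul_conj_re hAp.1 hBp.1
  have hτ0 : 0 ≤ τ := trace_mul_re_nonneg hAp hBp
  set F := Real.sqrt (τ + 2 * δ)
  have hFF : F * F = τ + 2 * δ := Real.mul_self_sqrt (by positivity)
  have hF0 : 0 < F := Real.sqrt_pos.2 (by positivity)
  have hFc : (F : ℂ) ≠ 0 := by exact_mod_cast hF0.ne'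
  have hac : (a : ℂ) ≠ 0 := by exact_mod_cast hAd.ne'
  -- `Q / F` is the geometric mean of `A⁻¹` and `B`, the positive solution of `X A X = B`; `F` is
  -- the qubit fidelity of `A` and `B`.
  obtain ⟨Q, hQ⟩ : ∃ Q, Q = B + ((δ / a : ℝ) : ℂ) • A.adjugate := ⟨_, rfl⟩
  have hQh : Q.IsHermitian := by
    rw [IsHermitian, hQ, conjTranspose_add, conjTranspose_smul, hBp.1.eq, adjugate_conjTranspose,
      hAp.1.eq]
    simp
  have hAQ : A * Q = A * B + (δ : ℂ) • 1 := by
    rw [hQ, mul_add, mul_smul_comm, mul_adjugate, hda, smul_smul]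
    congr 2
    push_cast
    field_simp
  have hAQt : (A * Q).trace = (F : ℂ) * F := by
    rw [hAQ, trace_add, hτ, trace_smul, trace_one, ← Complex.ofReal_mul, hFF]
    simp
    ring
  have hQAQ : Q * A * Q = ((F : ℂ) * F) • B := by
    have e1 : Q * A * Q = B * A * B + (2 * δ : ℂ) • B + ((δ / a * δ : ℝ) : ℂ) • A.adjugate := by
      rw [mul_assoc, hAQ, hQ, mul_add, add_mul, add_mul, mul_assoc, smul_mul_assoc, ← mul_assoc A.adjugate,
        adjugate_mul, hda, smul_mul_assoc, one_mul, smul_smul]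
      have : ((δ / a : ℝ) : ℂ) * a = δ := by
        push_cast
        field_simp
      rw [this]
      simp only [mul_smul_comm, mul_one]
      push_cast
      module
    have e2 : δ / a * δ = b := by
      field_simp
      linarith
    rw [e1, e2, ← hdb, add_right_comm, mul_mul_add_det_smul_adjugate, hτ, ← add_smul,
      ← Complex.ofReal_mul, hFF]
    push_cast
    rfl
  obtain ⟨g, hg⟩ : ∃ g, g = (Gᴴ * G) 1 0 := ⟨_, rfl⟩
  have hg' : (Gᴴ * G) 0 1 = star g := by
    rw [hg]
    exact ((isHermitian_conjTranspose_mul_self G).apply 0 1).symm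
  rw [← hg] at hF
  -- `D` collects the operators with `D k * A * (D l)ᴴ` as the off-diagonal blocks
  set D : Fin 2 → Op (Fin 2) := ![1, (star g / (F * F)) • Q] with hD
  set W : Matrix (Fin 2 × Fin 2) (Fin 2) ℂ := Matrix.of fun p m => D p.2 p.1 m with hW
  -- The block built from `Q` yields only the fraction `|g|² / F²` of `B`; `μ` supplies the rest,
  -- and the fidelity hypothesis is what makes it nonnegative.
  set μ : ℝ := 1 - Complex.normSq g / (F * F) with hμ
  have hμ0 : 0 ≤ μ := by
    rw [hμ, sub_nonneg, div_le_one (by positivity), hFF]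
    exact hF
  set C : Op (Fin 2 × Fin 2) := W * A * Wᴴ +
    kroneckerMap (· * ·) ((μ : ℂ) • B) (single 1 1 1) with hC
  have hE : (single 1 1 1 : Op (Fin 2)).PosSemidef := by
    have := posSemidef_conjTranspose_mul_self (single 1 1 1 : Op (Fin 2))
    simpa using this
  have hCp : C.PosSemidef :=
    (hAp.mul_mul_conjTranspose_same W).add
      ((hBp.smul (by rw [Complex.zero_le_real]; exact hμ0)).kronecker hE)
  have hblock : ∀ k l i j, C (i, k) (j, l) =
      (D k * A * (D l)ᴴ + (single 1 1 (1 : ℂ) : Op (Fin 2)) k l • ((μ : ℂ) • B)) i j := by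
    intro k l i j
    simp [hC, hW, mul_apply, conjTranspose_apply, mul_comm]
  have h00 : ∀ i j, C (i, 0) (j, 0) = A i j := fun i j => by
    rw [hblock]
    simp [hD]
  have hgg : (Complex.normSq g : ℂ) = star g * g := Complex.normSq_eq_conj_mul_self
  have h11 : ∀ i j, C (i, 1) (j, 1) = B i j := fun i j => by
    rw [hblock]
    have e : D 1 * A * (D 1)ᴴ = ((Complex.normSq g / (F * F) : ℝ) : ℂ) • B := by
      simp only [hD, cons_val_one, cons_val_fin_one, conjTranspose_smul, hQh.eq, smul_mul_assoc,
        mul_smul_comm, hQAQ, smul_smul]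
      congr 1
      push_cast
      rw [hgg]
      simp
      field_simp
    rw [e, single_apply_same, one_smul, ← add_smul, ← Complex.ofReal_add, hμ]
    simp
  -- This is trace preservation in the nonorthogonal frame: the trace of `G y Gᴴ` is the sum of `y k
  -- l * (Gᴴ * G) l k`.
  have htr : ∀ k l, ∑ i, C (i, k) (i, l) = (Gᴴ * G) l k := by
    have hQAt : (Q * A).trace = (F : ℂ) * F := by rw [trace_mul_comm, hAQt]
    intro k l
    fin_cases k <;> fin_cases l
    · simp only [Fin.zero_eta, h00, hG0]
      exact hAt
    · change ∑ i, C (i, 0) (i, 1) = (Gᴴ * G) 1 0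
      simp only [hblock]
      change (D 0 * A * (D 1)ᴴ + _).trace = _
      rw [← hg, trace_add]
      simp [hD, conjTranspose_smul, hQh.eq, hAQt]
      field_simp
    · change ∑ i, C (i, 1) (i, 0) = (Gᴴ * G) 0 1
      simp only [hblock]
      change (D 1 * A * (D 0)ᴴ + _).trace = _
      rw [hg', trace_add]
      simp [hD, hQAt]
      field_simp
    · simp only [Fin.mk_one, h11, hG1]
      exact hBt
  refine ⟨ofChoi C ∘ₗ conjugation G⁻¹, ⟨(isCompletelyPositive_ofChoi hCp).comp
    (isCompletelyPositive_conjugation _), fun X => ?_⟩, ?_, ?_⟩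
  · rw [LinearMap.comp_apply]
    set y := conjugation G⁻¹ X with hy
    have e1 : X = G * y * Gᴴ := (conjugation_inv_conjugation hG X).symm
    rw [e1, trace_mul_comm, ← mul_assoc, trace_mul_comm]
    simp only [trace, diag, ofChoi_apply]
    rw [Finset.sum_comm]
    refine Finset.sum_congr rfl fun k _ => ?_
    rw [Finset.sum_comm, mul_apply]
    refine Finset.sum_congr rfl fun l _ => ?_
    rw [← Finset.mul_sum, htr]
  · rw [LinearMap.comp_apply, inv_conjugation_single hG]
    ext i j
    rw [ofChoi_single, h00]
  · rw [LinearMap.comp_apply, inv_conjugation_single hG]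
    ext i j
    rw [ofChoi_single, h11]

theorem det_smul_sub_smul {A B : Op (Fin 2)} (hA : A.trace = 1) (hB : B.trace = 1) (p q : ℂ) :
    (p • A - q • B).det = p ^ 2 * A.det + q ^ 2 * B.det - p * q * (1 - (A * B).trace) := by
  rw [trace_fin_two] at hA hB
  have hA' : A 1 1 = 1 - A 0 0 := by linear_combination hA
  have hB' : B 1 1 = 1 - B 0 0 := by linear_combination hB
  simp only [det_fin_two, trace_fin_two, mul_apply, Fin.sum_univ_two, Matrix.sub_apply,
    Matrix.smul_apply, smul_eq_mul, hA', hB']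
  ring

theorem det_depolarize {M : Op (Fin 2)} (hM : M.IsHermitian) (ε : ℝ) :
    (((1 - ε : ℝ) : ℂ) • M + ((ε / 2 * M.trace.re : ℝ) : ℂ) • 1).det.re =
      (1 - ε) ^ 2 * M.det.re + (1 - (1 - ε) ^ 2) * (M.trace.re ^ 2 / 4) := by
  obtain ⟨a, b, z, rfl⟩ := exists_eq_of_isHermitian_fin_two hM
  have ht : (!![(a : ℂ), z; star z, (b : ℂ)] : Op (Fin 2)).trace.re = a + b := by
    simp [trace_fin_two]
  have e : ((1 - ε : ℝ) : ℂ) • !![(a : ℂ), z; star z, (b : ℂ)] +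
      ((ε / 2 * (a + b) : ℝ) : ℂ) • (1 : Op (Fin 2)) =
      !![(((1 - ε) * a + ε / 2 * (a + b) : ℝ) : ℂ), ((1 - ε : ℝ) : ℂ) * z;
        star (((1 - ε : ℝ) : ℂ) * z), (((1 - ε) * b + ε / 2 * (a + b) : ℝ) : ℂ)] := by
    ext i j
    fin_cases i <;> fin_cases j <;> simp
  rw [ht, e, det_hermitian_fin_two, det_hermitian_fin_two, Complex.ofReal_re, Complex.ofReal_re,
    Complex.normSq_mul, Complex.normSq_ofReal]
  ring

theorem det_re_le_trace_sq {M : Op (Fin 2)} (hM : M.IsHermitian) :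
    M.det.re ≤ M.trace.re ^ 2 / 4 := by
  obtain ⟨a, b, z, rfl⟩ := exists_eq_of_isHermitian_fin_two hM
  rw [det_hermitian_fin_two, Complex.ofReal_re]
  have := Complex.normSq_nonneg z
  simp [trace_fin_two]
  nlinarith [sq_nonneg (a - b)]

/-- The Alberti–Uhlmann theorem for a pair of pure qubit states, with the columns of `G` as state
vectors. -/
theorem exists_isCPTP_of_traceNorm_le {G A B : Op (Fin 2)} (hG : IsUnit G.det)
    (hG0 : (G * single 0 0 1 * Gᴴ).trace = 1) (hG1 : (G * single 1 1 1 * Gᴴ).trace = 1)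
    (hA : IsState A) (hB : IsState B)
    (h : ∀ p q : ℝ, traceNorm ((p : ℂ) • A - (q : ℂ) • B) ≤
      traceNorm ((p : ℂ) • (G * single 0 0 1 * Gᴴ) - (q : ℂ) • (G * single 1 1 1 * Gᴴ))) :
    ∃ T : Op (Fin 2) →ₗ[ℂ] Op (Fin 2), IsCPTP T ∧ T (G * single 0 0 1 * Gᴴ) = A ∧
      T (G * single 1 1 1 * Gᴴ) = B := by
  set P : Op (Fin 2) := G * single 0 0 1 * Gᴴ with hP
  set Q : Op (Fin 2) := G * single 1 1 1 * Gᴴ with hQ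
  have htr : ∀ k l, (G * single k l 1 * Gᴴ).trace = (Gᴴ * G) l k := by
    intro k l
    simp only [trace, diag]
    rw [mul_apply]
    refine Finset.sum_congr rfl fun i _ => ?_
    rw [mul_single_mul_conjTranspose_apply, conjTranspose_apply, mul_comm]
  have hg0 : (Gᴴ * G) 0 0 = 1 := (htr 0 0).symm.trans hG0
  have hg1 : (Gᴴ * G) 1 1 = 1 := (htr 1 1).symm.trans hG1
  set κ := Complex.normSq ((Gᴴ * G) 1 0) with hκ
  have hg01 : (Gᴴ * G) 0 1 = star ((Gᴴ * G) 1 0) :=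
    ((isHermitian_conjTranspose_mul_self G).apply 0 1).symm
  have hPQ : (P * Q).trace = (κ : ℂ) := by
    have e : P * Q = (Gᴴ * G) 0 1 • (G * single 0 1 1 * Gᴴ) := by
      have e1 : P * Q = G * (single 0 0 1 * (Gᴴ * G) * single 1 1 1) * Gᴴ := by
        simp only [hP, hQ, mul_assoc]
      have e2 : (single 0 0 1 * (Gᴴ * G) * single 1 1 1 : Op (Fin 2)) =
          (Gᴴ * G) 0 1 • single 0 1 1 := by
        generalize Gᴴ * G = R
        ext i j
        fin_cases i <;> fin_cases j <;> simp [mul_apply, single_apply]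
      rw [e1, e2, mul_smul_comm, smul_mul_assoc]
    rw [e, trace_smul, htr, hg01, hκ, Complex.normSq_eq_conj_mul_self]
    rfl
  have hκ1 : κ ≤ 1 := by
    have h1 : (Gᴴ * G).det.re = 1 - κ := by
      rw [det_fin_two, hg0, hg1, hg01, hκ, Complex.normSq_apply]
      simp
    have h2 := Complex.le_def.1 (posSemidef_conjTranspose_mul_self G).det_nonneg
    have h3 := h2.1
    rw [h1, Complex.zero_re] at h3
    linarith
  have hsing : ∀ i : Fin 2, (G * single i i 1 * Gᴴ).det = 0 := fun i => by
    rw [det_mul, det_mul]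
    fin_cases i <;> simp [det_fin_two]
  have hPh : P.IsHermitian := by
    rw [IsHermitian, hP, conjTranspose_mul, conjTranspose_mul, conjTranspose_conjTranspose,
      conjTranspose_single, star_one, mul_assoc]
  have hQh : Q.IsHermitian := by
    rw [IsHermitian, hQ, conjTranspose_mul, conjTranspose_mul, conjTranspose_conjTranspose,
      conjTranspose_single, star_one, mul_assoc]
  have hsmul : ∀ (r : ℝ) (M : Op (Fin 2)), M.IsHermitian → ((r : ℂ) • M).IsHermitian :=
    fun r M hM => by simp [IsHermitian, conjTranspose_smul, hM.eq]
  have hdetPQ : ∀ p q : ℝ, ((p : ℂ) • P - (q : ℂ) • Q).det.re = -(p * q * (1 - κ)) := by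
    intro p q
    rw [det_smul_sub_smul hG0 hG1, hsing, hsing, hPQ]
    have : (p : ℂ) ^ 2 * 0 + (q : ℂ) ^ 2 * 0 - p * q * (1 - (κ : ℂ)) =
      ((-(p * q * (1 - κ)) : ℝ) : ℂ) := by push_cast; ring
    rw [this, Complex.ofReal_re]
  have hcond : ∀ p q : ℝ, 0 ≤ p → 0 ≤ q →
      -(p * q * (1 - κ)) ≤ ((p : ℂ) • A - (q : ℂ) • B).det.re := by
    intro p q hp hq
    rw [← hdetPQ]
    refine det_le_det_of_traceNorm_le ((hsmul p A hA.1.1).sub (hsmul q B hB.1.1))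
      ((hsmul p P hPh).sub (hsmul q Q hQh)) ?_ (h p q) ?_
    · rw [trace_sub, trace_sub, trace_smul, trace_smul, trace_smul, trace_smul, hA.2, hB.2, hG0,
        hG1]
    · rw [hdetPQ]
      have : 0 ≤ p * q * (1 - κ) := mul_nonneg (mul_nonneg hp hq) (by linarith)
      linarith
  -- mixing with the maximally mixed state makes both targets invertible
  let mix : ℝ → Op (Fin 2) → Op (Fin 2) := fun ε M =>
    ((1 - ε : ℝ) : ℂ) • M + ((ε / 2 : ℝ) : ℂ) • 1
  have hmixstate : ∀ ε M, 0 < ε → ε ≤ 1 → IsState M → IsState (mix ε M) := by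
    intro ε M h0 h1 hM
    refine ⟨(hM.1.smul ?_).add (PosSemidef.one.smul ?_), ?_⟩
    · rw [Complex.zero_le_real]; linarith
    · rw [Complex.zero_le_real]; positivity
    · rw [trace_add, trace_smul, trace_smul, hM.2, trace_one]
      simp
  have hmixdet : ∀ ε M, 0 < ε → ε ≤ 1 → IsState M → 0 < (mix ε M).det.re := by
    intro ε M h0 h1 hM
    have e := det_depolarize hM.1.1 ε
    rw [hM.2, Complex.one_re, mul_one] at e
    change 0 < (((1 - ε : ℝ) : ℂ) • M + ((ε / 2 : ℝ) : ℂ) • (1 : Op (Fin 2))).det.re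
    rw [e]
    have h2 : 0 ≤ M.det.re := (Complex.le_def.1 hM.1.det_nonneg).1
    have h3 : 0 < 1 - (1 - ε) ^ 2 := by nlinarith
    positivity
  have hT : ∀ ε : ℝ, 0 < ε → ε ≤ 1 → ∃ T : Op (Fin 2) →ₗ[ℂ] Op (Fin 2), IsCPTP T ∧
      T P = mix ε A ∧ T Q = mix ε B := by
    intro ε h0 h1
    have hA' := hmixstate ε A h0 h1 hA
    have hB' := hmixstate ε B h0 h1 hB
    refine exists_isCPTP_of_fidelity hG hg0 hg1 hA' hB' (hmixdet ε A h0 h1 hA)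
      (hmixdet ε B h0 h1 hB) ?_
    set a := (mix ε A).det.re with ha
    set b := (mix ε B).det.re with hb
    have ha0 : 0 < a := hmixdet ε A h0 h1 hA
    have hb0 : 0 < b := hmixdet ε B h0 h1 hB
    -- These weights give `p² a + q² b = 2 (p q)²`, so the determinant inequality divided by `p q`
    -- is precisely the fidelity bound.
    set p := Real.sqrt b
    set q := Real.sqrt a
    have hp0 : 0 < p := Real.sqrt_pos.2 hb0
    have hq0 : 0 < q := Real.sqrt_pos.2 ha0
    have hp2 : p * p = b := Real.mul_self_sqrt hb0.le
    have hq2 : q * q = a := Real.mul_self_sqrt ha0.le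
    have hqp : Real.sqrt (a * b) = p * q := by
      rw [Real.sqrt_mul ha0.le, mul_comm]
    set M : Op (Fin 2) := (p : ℂ) • A - (q : ℂ) • B with hM
    have hMh : M.IsHermitian := (hsmul p A hA.1.1).sub (hsmul q B hB.1.1)
    have hMt : M.trace.re = p - q := by
      rw [hM, trace_sub, trace_smul, trace_smul, hA.2, hB.2]
      simp
    have e1 : (p : ℂ) • mix ε A - (q : ℂ) • mix ε B =
        ((1 - ε : ℝ) : ℂ) • M + ((ε / 2 * M.trace.re : ℝ) : ℂ) • 1 := by
      rw [hMt, hM]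
      simp only [mix]
      push_cast
      module
    have e2 := det_depolarize hMh ε
    rw [← e1, det_smul_sub_smul hA'.2 hB'.2, det_eq_re hA'.1.1, det_eq_re hB'.1.1,
      trace_mul_conj_re hA'.1.1 hB'.1.1, ← ha, ← hb] at e2
    have e3 : ((p : ℂ) ^ 2 * (a : ℂ) + (q : ℂ) ^ 2 * (b : ℂ) -
        p * q * (1 - ((mix ε A * mix ε B).trace.re : ℂ))).re =
        p ^ 2 * a + q ^ 2 * b - p * q * (1 - (mix ε A * mix ε B).trace.re) := by
      rw [← Complex.ofReal_re (p ^ 2 * a + q ^ 2 * b - p * q * (1 - (mix ε A * mix ε B).trace.re))]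
      congr 1
      push_cast
      ring
    rw [e3] at e2
    have h4 := det_re_le_trace_sq hMh
    have h5 := hcond p q hp0.le hq0.le
    rw [← hM] at h5
    -- Depolarizing moves the determinant toward its maximum `(tr M)² / 4`, so `hcond` survives the
    -- mixing.
    have h6 : M.det.re ≤ (1 - ε) ^ 2 * M.det.re + (1 - (1 - ε) ^ 2) * (M.trace.re ^ 2 / 4) := by
      have : 0 ≤ 1 - (1 - ε) ^ 2 := by nlinarith
      nlinarith
    rw [hqp]
    have h7 : p ^ 2 * a + q ^ 2 * b = (p * q) * (2 * (p * q)) := by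
      rw [← hp2, ← hq2]; ring
    have h8 : 0 < p * q := by positivity
    have h9 : (p * q) * κ ≤ (p * q) * ((mix ε A * mix ε B).trace.re + 2 * (p * q)) := by
      nlinarith
    exact le_of_mul_le_mul_left h9 h8
  have hseq : ∀ k : ℕ, (0 : ℝ) < 1 / ((k : ℝ) + 1) ∧ 1 / ((k : ℝ) + 1) ≤ 1 := fun k => by
    refine ⟨by positivity, ?_⟩
    rw [div_le_one (by positivity)]
    have : (0 : ℝ) ≤ k := by positivity
    linarith
  choose T hTc hTP hTQ using fun k : ℕ => hT _ (hseq k).1 (hseq k).2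
  obtain ⟨E, hE, φ, hφ, hlim⟩ := IsCPTP.exists_tendsto_subseq hTc
  have hmixlim : ∀ M, Tendsto (fun k => mix (1 / ((φ k : ℝ) + 1)) M) atTop (𝓝 M) := by
    intro M
    have c : Continuous fun ε : ℝ => mix ε M := by
      simp only [mix]
      fun_prop
    have h1 := (c.tendsto 0).comp
      ((tendsto_one_div_add_atTop_nhds_zero_nat (𝕜 := ℝ)).comp hφ.tendsto_atTop)
    simpa [mix, Function.comp_def] using h1
  refine ⟨E, hE, ?_, ?_⟩
  · refine tendsto_nhds_unique (hlim (fun _ => P) P tendsto_const_nhds) ?_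
    simp only [hTP]
    exact hmixlim A
  · refine tendsto_nhds_unique (hlim (fun _ => Q) Q tendsto_const_nhds) ?_
    simp only [hTQ]
    exact hmixlim B

end Qubit

/-! ### Noninvertible qubit evolutions. -/

section QubitEvolution

theorem single_mem_span_conjugation {G : Op (Fin 2)} (hG : IsUnit G.det) {Y : Op (Fin 2)}
    (h01 : conjugation G⁻¹ Y 0 1 = 0) (h10 : conjugation G⁻¹ Y 1 0 = 0) :
    Y ∈ Submodule.span ℂ (range fun i : Fin 2 => G * single i i 1 * Gᴴ) := by
  set Z := conjugation G⁻¹ Y with hZ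
  have e : Z = Z 0 0 • single 0 0 1 + Z 1 1 • single 1 1 1 := by
    ext i j
    fin_cases i <;> fin_cases j <;> simp [h01, h10]
  rw [← conjugation_inv_conjugation hG Y, ← hZ, e, mul_add, add_mul, mul_smul_comm, mul_smul_comm,
    smul_mul_assoc, smul_mul_assoc]
  exact Submodule.add_mem _
    (Submodule.smul_mem _ _ (Submodule.subset_span ⟨0, rfl⟩))
    (Submodule.smul_mem _ _ (Submodule.subset_span ⟨1, rfl⟩))

/-- A completely positive qubit map that is not injective cannot fix the three-dimensional range
of a qubit channel. -/
theorem finrank_range_le_two_of_fixed {L E : Op (Fin 2) →ₗ[ℂ] Op (Fin 2)} (hL : IsCPTP L)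
    (hE : IsCompletelyPositive E) (hEL : ∀ Y, E (L Y) = L Y) (hninj : ¬ Function.Injective E) :
    Module.finrank ℂ (LinearMap.range L) ≤ 2 := by
  by_cases hconst : ∃ P, IsState P ∧ ∀ Y, L Y = Y.trace • P
  · obtain ⟨P, -, hP⟩ := hconst
    have h1 : LinearMap.range L ≤ Submodule.span ℂ {P} := by
      rintro _ ⟨Y, rfl⟩
      rw [hP]
      exact Submodule.smul_mem _ _ (Submodule.mem_span_singleton_self P)
    exact (Submodule.finrank_mono h1).trans ((finrank_span_le_card ({P} : Set (Op (Fin 2)))).trans (by simp))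
  obtain ⟨G, hG, W, hW⟩ := hL.exists_pure_states hconst
  set E' : Op (Fin 2) →ₗ[ℂ] Op (Fin 2) := conjugation G⁻¹ ∘ₗ E ∘ₗ conjugation G with hE'
  have hE'cp : IsCompletelyPositive E' :=
    (isCompletelyPositive_conjugation _).comp (hE.comp (isCompletelyPositive_conjugation _))
  have hE'app : ∀ Y, E' (conjugation G⁻¹ Y) = conjugation G⁻¹ (E Y) := fun Y => by
    simp only [hE', LinearMap.comp_apply]
    rw [conjugation_apply G, conjugation_inv_conjugation hG]
  have hdiag : ∀ i : Fin 2, E' (single i i 1) = single i i 1 := by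
    intro i
    have h1 := hE'app (L (W i))
    rw [hEL, (hW i).2.2, inv_conjugation_single hG] at h1
    exact h1
  have hC := hE'cp.choi_posSemidef
  -- `E'` fixes both diagonal units, so these diagonal Choi entries vanish and positivity kills
  -- their rows. What remains is a Schur multiplier with off-diagonal factor `c`.
  have hz : ∀ i k j l : Fin 2, i ≠ k → choi E' (i, k) (j, l) = 0 := by
    intro i k j l hik
    refine hC.apply_eq_zero ?_ _
    rw [choi_apply, hdiag]
    simp [hik.symm]
  have hz' : ∀ i k j l : Fin 2, j ≠ l → choi E' (i, k) (j, l) = 0 := by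
    intro i k j l hjl
    rw [← hC.1.apply, hz j l i k hjl, star_zero]
  have hoff : ∀ k l : Fin 2, E' (single k l 1) = choi E' (k, k) (l, l) • single k l 1 := by
    intro k l
    ext i j
    rw [← choi_apply E' (i, k) (j, l), Matrix.smul_apply, single_apply]
    by_cases hi : i = k
    · subst hi
      by_cases hj : j = l
      · subst hj
        simp
      · rw [hz' _ _ _ _ hj]
        simp [Ne.symm hj]
    · rw [hz _ _ _ _ hi]
      simp [Ne.symm hi]
  set c := choi E' (0, 0) (1, 1) with hc
  have hc' : choi E' (1, 1) (0, 0) = star c := (hC.1.apply _ _).symm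
  have hform : ∀ Z, E' Z = Z 0 0 • single 0 0 1 + (Z 0 1 * c) • single 0 1 1 +
      (Z 1 0 * star c) • single 1 0 1 + Z 1 1 • single 1 1 1 := by
    intro Z
    have e : Z = Z 0 0 • single 0 0 1 + Z 0 1 • single 0 1 1 + Z 1 0 • single 1 0 1 +
        Z 1 1 • single 1 1 1 := by
      ext i j
      fin_cases i <;> fin_cases j <;> simp
    conv_lhs => rw [e]
    rw [map_add, map_add, map_add, map_smul, map_smul, map_smul, map_smul, hdiag, hdiag, hoff 0 1,
      hoff 1 0, ← hc, hc', smul_smul, smul_smul]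
  -- With `c = 1` the map `E` would be the identity. For `c ≠ 1` the fixed points of `E'` are the
  -- diagonal matrices, of dimension two.
  have hc1 : c ≠ 1 := by
    intro h1
    apply hninj
    have hid : ∀ Y, E Y = Y := by
      intro Y
      have h2 : E' (conjugation G⁻¹ Y) = conjugation G⁻¹ Y := by
        rw [hform, h1]
        ext i j
        fin_cases i <;> fin_cases j <;> simp
      rw [hE'app] at h2
      rw [← conjugation_inv_conjugation hG (E Y), h2, conjugation_inv_conjugation hG]
    intro X Y hXY
    rwa [hid, hid] at hXY
  have hc1' : star c ≠ 1 := fun h1 => hc1 (by rw [← star_star c, h1, star_one])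
  have hspan : LinearMap.range L ≤
      Submodule.span ℂ (range fun i : Fin 2 => G * single i i 1 * Gᴴ) := by
    rintro _ ⟨Y, rfl⟩
    have h1 := hE'app (L Y)
    rw [hEL, hform] at h1
    have h01 : ∀ Z : Op (Fin 2), Z 0 0 • single 0 0 1 + (Z 0 1 * c) • single 0 1 1 +
        (Z 1 0 * star c) • single 1 0 1 + Z 1 1 • single 1 1 1 = Z → Z 0 1 = 0 ∧ Z 1 0 = 0 := by
      intro Z hZ
      have e01 : Z 0 1 * c = Z 0 1 := by simpa using congrFun (congrFun hZ 0) 1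
      have e10 : Z 1 0 * star c = Z 1 0 := by simpa using congrFun (congrFun hZ 1) 0
      have f01 : Z 0 1 * (c - 1) = 0 := by rw [mul_sub, mul_one, e01, sub_self]
      have f10 : Z 1 0 * (star c - 1) = 0 := by rw [mul_sub, mul_one, e10, sub_self]
      exact ⟨(mul_eq_zero.1 f01).resolve_right (sub_ne_zero.2 hc1),
        (mul_eq_zero.1 f10).resolve_right (sub_ne_zero.2 hc1')⟩
    exact single_mem_span_conjugation hG (h01 _ h1).1 (h01 _ h1).2
  exact (Submodule.finrank_mono hspan).trans ((finrank_range_le_card _).trans (by simp))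

theorem linearIndependent_conjugation_single {G : Op (Fin 2)} (hG : IsUnit G.det) :
    LinearIndependent ℂ fun i : Fin 2 => G * single i i 1 * Gᴴ := by
  rw [Fintype.linearIndependent_iff]
  intro g hg i
  have h := congrArg (conjugation G⁻¹) hg
  rw [map_sum, map_zero] at h
  simp only [map_smul, inv_conjugation_single hG] at h
  have h2 := congrFun (congrFun h i) i
  fin_cases i <;> simpa [Fin.sum_univ_two] using h2

/-- A trace-norm contraction on the range of a qubit channel of rank at most two extends to a
quantum operation. -/
theorem exists_isCPTP_comp_of_finrank_le_two {L M : Op (Fin 2) →ₗ[ℂ] Op (Fin 2)} (hL : IsCPTP L)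
    (hM : IsCPTP M) (hker : LinearMap.ker L ≤ LinearMap.ker M)
    (hctr : ∀ X : Op (Fin 2), X.IsHermitian → traceNorm (M X) ≤ traceNorm (L X))
    (hrank : Module.finrank ℂ (LinearMap.range L) ≤ 2) :
    ∃ V : Op (Fin 2) →ₗ[ℂ] Op (Fin 2), IsCPTP V ∧ M = V ∘ₗ L := by
  have hfac : ∀ X Y, L X = L Y → M X = M Y := fun X Y hXY => by
    have h1 : X - Y ∈ LinearMap.ker L := by rw [LinearMap.mem_ker, map_sub, hXY, sub_self]
    have h2 := LinearMap.mem_ker.1 (hker h1)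
    rwa [map_sub, sub_eq_zero] at h2
  by_cases hconst : ∃ P, IsState P ∧ ∀ Y, L Y = Y.trace • P
  · obtain ⟨P, hP, hLP⟩ := hconst
    have h1 : IsState (M P) := ⟨hM.1.map_posSemidef hP.1, by rw [hM.trace_map, hP.2]⟩
    refine ⟨constantChannel (M P), isCPTP_constantChannel h1, ?_⟩
    ext1 Y
    rw [LinearMap.comp_apply, constantChannel_apply, hL.trace_map, ← map_smul]
    refine hfac _ _ ?_
    rw [map_smul, hLP Y, hLP P, hP.2, one_smul]
  obtain ⟨G, hG, W, hW⟩ := hL.exists_pure_states hconst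
  have hp : ∀ i : Fin 2, (G * single i i 1 * Gᴴ).PosSemidef := by
    intro i
    have h1 : (single i i 1 : Op (Fin 2)).PosSemidef := by
      have := posSemidef_conjTranspose_mul_self (single i i 1 : Op (Fin 2))
      simpa using this
    exact h1.mul_mul_conjTranspose_same G
  -- `W i` may fail to be positive, but `L (W i)` is a state, so contraction bounds the trace norm
  -- of `M (W i)` by its trace 1.
  have hMW : ∀ i, IsState (M (W i)) := fun i => by
    have ht : (M (W i)).trace = 1 := by rw [hM.trace_map, (hW i).2.1]
    refine ⟨PosSemidef.of_traceNorm_le (hM.1.map_isHermitian (hW i).1) ?_, ht⟩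
    refine (hctr _ (hW i).1).trans ?_
    rw [(hW i).2.2, (hp i).traceNorm_eq, ← (hW i).2.2, hL.trace_map, hM.trace_map]
  have htr : ∀ i, (G * single i i 1 * Gᴴ).trace = 1 := fun i => by
    rw [← (hW i).2.2, hL.trace_map, (hW i).2.1]
  obtain ⟨T, hT, hT0, hT1⟩ := exists_isCPTP_of_traceNorm_le hG (htr 0) (htr 1) (hMW 0) (hMW 1)
    (by
      intro p q
      have h1 := hctr ((p : ℂ) • W 0 - (q : ℂ) • W 1)
        (IsHermitian.sub (by simp [IsHermitian, conjTranspose_smul, (hW 0).1.eq])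
          (by simp [IsHermitian, conjTranspose_smul, (hW 1).1.eq]))
      simpa only [map_sub, map_smul, (hW _).2.2] using h1)
  have hTi : ∀ i, T (G * single i i 1 * Gᴴ) = M (W i) := by
    intro i
    fin_cases i
    · exact hT0
    · exact hT1
  refine ⟨T, hT, ?_⟩
  -- The rank bound enters here: two independent pure states exhaust the range, so agreement on them
  -- determines the factorization.
  have hspan : Submodule.span ℂ (range fun i : Fin 2 => G * single i i 1 * Gᴴ) =
      LinearMap.range L := by
    refine Submodule.eq_of_le_of_finrank_le ?_ ?_
    · rw [Submodule.span_le]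
      rintro _ ⟨i, rfl⟩
      exact ⟨W i, (hW i).2.2⟩
    · rw [finrank_span_eq_card (linearIndependent_conjugation_single hG)]
      simpa using hrank
  ext1 Y
  have hmem : L Y ∈ Submodule.span ℂ (range fun i : Fin 2 => G * single i i 1 * Gᴴ) := by
    rw [hspan]
    exact ⟨Y, rfl⟩
  obtain ⟨c, hc⟩ := (Submodule.mem_span_range_iff_exists_fun ℂ).1 hmem
  rw [LinearMap.comp_apply, ← hc, map_sum]
  simp only [map_smul, hTi]
  have h2 : L Y = L (∑ i, c i • W i) := by
    rw [map_sum, ← hc]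
    simp only [map_smul, (hW _).2.2]
  rw [hfac _ _ h2, map_sum]
  simp only [map_smul]

theorem antitoneOn_traceNorm_apply {d : ℕ}
    {Λ : ℝ → Op (Fin d) →ₗ[ℂ] Op (Fin d)}
    (hmono : ∀ (k : ℕ) (X : Op (Fin d × Fin k)), X.IsHermitian →
      AntitoneOn (fun τ => traceNorm (ampliation (Fin k) (Λ τ) X)) (Ici 0))
    {X : Op (Fin d)} (hX : X.IsHermitian) :
    AntitoneOn (fun τ => traceNorm (Λ τ X)) (Ici 0) := by
  have h := hmono 1 (X.submatrix Prod.fst Prod.fst) (hX.submatrix _)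
  have e : ∀ τ, ampliation (Fin 1) (Λ τ) (X.submatrix Prod.fst Prod.fst) =
      (Λ τ X).submatrix (Equiv.prodUnique (Fin d) (Fin 1)) (Equiv.prodUnique (Fin d) (Fin 1)) :=
    fun τ => rfl
  have e2 : ∀ Y : Op (Fin d), traceNorm (Y.submatrix (Equiv.prodUnique (Fin d) (Fin 1))
      (Equiv.prodUnique (Fin d) (Fin 1))) = traceNorm Y := fun Y =>
    traceNorm_reindex (Equiv.prodUnique (Fin d) (Fin 1)).symm Y
  simpa only [e, e2] using h

theorem ker_le_ker_of_traceNorm_le {n : Type} [Fintype n] [DecidableEq n]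
    {L M : Op n →ₗ[ℂ] Op n} (hL : IsCPTP L)
    (hctr : ∀ X : Op n, X.IsHermitian → traceNorm (M X) ≤ traceNorm (L X)) :
    LinearMap.ker L ≤ LinearMap.ker M := by
  have hz : ∀ X : Op n, X.IsHermitian → L X = 0 → M X = 0 := fun X hX h0 => by
    refine eq_zero_of_traceNorm_eq_zero (le_antisymm ?_ (traceNorm_nonneg _))
    refine (hctr X hX).trans ?_
    rw [h0, PosSemidef.zero.traceNorm_eq]
    simp
  intro X hX
  rw [LinearMap.mem_ker] at hX ⊢
  obtain ⟨A, B, hA, hB, rfl⟩ := exists_isHermitian_add_smul_I X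
  rw [map_add, map_smul] at hX ⊢
  have h1 := congrArg conjTranspose hX
  rw [conjTranspose_add, conjTranspose_smul, (hL.1.map_isHermitian hA).eq,
    (hL.1.map_isHermitian hB).eq, conjTranspose_zero, Complex.star_def, Complex.conj_I,
    neg_smul] at h1
  have hLA : L A = 0 := by
    have h2 : (2 : ℂ) • L A = 0 := by
      rw [two_smul]
      calc L A + L A = (L A + Complex.I • L B) + (L A + -(Complex.I • L B)) := by abel
        _ = 0 := by rw [hX, h1, add_zero]
    exact (smul_eq_zero.1 h2).resolve_left two_ne_zero
  have hLB : L B = 0 := by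
    rw [hLA, zero_add] at hX
    exact (smul_eq_zero.1 hX).resolve_left Complex.I_ne_zero
  rw [hz A hA hLA, hz B hB hLB, smul_zero, add_zero]

theorem finrank_range_le_of_ker_le {n : Type} [Fintype n] [DecidableEq n] {L M : Op n →ₗ[ℂ] Op n}
    (h : LinearMap.ker L ≤ LinearMap.ker M) :
    Module.finrank ℂ (LinearMap.range M) ≤ Module.finrank ℂ (LinearMap.range L) := by
  have h1 := LinearMap.finrank_range_add_finrank_ker L
  have h2 := LinearMap.finrank_range_add_finrank_ker M
  have h3 := Submodule.finrank_mono h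
  omega

/-- Along a qubit evolution with nonincreasing trace norms, the rank of a noninvertible map is at
most two. -/
theorem finrank_range_le_two {Λ : ℝ → Op (Fin 2) →ₗ[ℂ] Op (Fin 2)} (hΛ : IsEvolution Λ)
    (hmono : ∀ (k : ℕ) (X : Op (Fin 2 × Fin k)), X.IsHermitian →
      AntitoneOn (fun τ => traceNorm (ampliation (Fin k) (Λ τ) X)) (Ici 0))
    {s : ℝ} (hs : 0 ≤ s) (hninj : ¬ Function.Injective (Λ s)) :
    Module.finrank ℂ (LinearMap.range (Λ s)) ≤ 2 := by
  set S : Set ℝ := {τ | 0 ≤ τ ∧ ¬ Function.Injective (Λ τ)} with hS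
  have hne : S.Nonempty := ⟨s, hs, hninj⟩
  have hbdd : BddBelow S := ⟨0, fun τ hτ => hτ.1⟩
  -- The first noninjective time: it belongs to `S` because noninjectivity is closed under limits,
  -- and it is positive because `Λ 0` is the identity.
  set t := sInf S with ht
  have ht0 : 0 ≤ t := le_csInf hne fun τ hτ => hτ.1
  have hts : t ≤ s := csInf_le hbdd ⟨hs, hninj⟩
  have hcont : ∀ {u : ℕ → ℝ}, Tendsto u atTop (𝓝 t) → (∀ k, 0 ≤ u k) → ∀ Y,
      Tendsto (fun k => Λ (u k) Y) atTop (𝓝 (Λ t Y)) := fun {u} hu hu0 Y =>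
    (hΛ.continuousOn_apply Y t ht0).tendsto.comp
      (tendsto_nhdsWithin_iff.2 ⟨hu, Eventually.of_forall hu0⟩)
  have htS : ¬ Function.Injective (Λ t) := by
    obtain ⟨u, -, hu, huS⟩ := exists_seq_tendsto_sInf hne hbdd
    obtain ⟨E, -, φ, hφ, hlim⟩ := IsCPTP.exists_tendsto_subseq fun k => hΛ.cptp (u k) (huS k).1
    have hEt : E = Λ t := by
      ext1 Y
      refine tendsto_nhds_unique (hlim (fun _ => Y) Y tendsto_const_nhds) ?_
      exact (hcont hu (fun k => (huS k).1) Y).comp hφ.tendsto_atTop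
    rw [← hEt]
    exact not_injective_of_tendsto (fun k => (huS k).2) hlim
  have htpos : 0 < t := by
    refine lt_of_le_of_ne ht0 fun h0 => htS ?_
    rw [← h0, hΛ.initial]
    exact Function.injective_id
  set u : ℕ → ℝ := fun k => t - t * (1 / ((k : ℝ) + 1)) with hu
  have hu1 : ∀ k : ℕ, (1 : ℝ) / ((k : ℝ) + 1) ≤ 1 := fun k => by
    rw [div_le_one (by positivity)]
    have : (0 : ℝ) ≤ k := by positivity
    linarith
  have hu0 : ∀ k, 0 ≤ u k := fun k => by
    have := hu1 k
    simp only [hu]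
    nlinarith
  have hult : ∀ k, u k < t := fun k => by
    have : 0 < t * (1 / ((k : ℝ) + 1)) := by positivity
    simp only [hu]
    linarith
  have hulim : Tendsto u atTop (𝓝 t) := by
    have := (tendsto_one_div_add_atTop_nhds_zero_nat (𝕜 := ℝ)).const_mul t
    rw [mul_zero] at this
    have h := this.const_sub t
    rwa [sub_zero] at h
  have huinj : ∀ k, Function.Injective (Λ (u k)) := fun k => by
    by_contra hcon
    exact absurd (csInf_le hbdd ⟨hu0 k, hcon⟩) (not_le.2 (hult k))
  choose V hV hVe using fun k =>
    exists_isCPTP_comp_of_injective hΛ hmono (hu0 k) (hult k).le (huinj k)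
  -- `V k` takes the injective `Λ (u k)` to the noninjective `Λ t`. As `u k` tends to `t`, a limit
  -- channel is noninjective and fixes the range of `Λ t`.
  have hVninj : ∀ k, ¬ Function.Injective (V k) := fun k hcon => by
    apply htS
    rw [hVe k]
    exact hcon.comp (huinj k)
  obtain ⟨E, hE, φ, hφ, hlim⟩ := IsCPTP.exists_tendsto_subseq hV
  have hEL : ∀ Y, E (Λ t Y) = Λ t Y := fun Y => by
    have h1 := hlim (fun k => Λ (u (φ k)) Y) (Λ t Y)
      ((hcont hulim hu0 Y).comp hφ.tendsto_atTop)
    have h2 : ∀ k, V (φ k) (Λ (u (φ k)) Y) = Λ t Y := fun k =>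
      (LinearMap.congr_fun (hVe (φ k)) Y).symm
    simp only [h2] at h1
    exact tendsto_nhds_unique h1 tendsto_const_nhds
  -- Contraction makes kernels grow with time, so the rank bound at `t` passes to the later time
  -- `s`.
  refine (finrank_range_le_of_ker_le (ker_le_ker_of_traceNorm_le (hΛ.cptp t ht0)
    fun X hX => ?_)).trans (finrank_range_le_two_of_fixed (hΛ.cptp t ht0) hE.1 hEL
      (not_injective_of_tendsto hVninj hlim))
  exact antitoneOn_traceNorm_apply hmono hX ht0 hs hts

end QubitEvolution

/-! ### Assembling the invertible and qubit cases. -/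

theorem exists_isHermitian_isUnit_of_injective {n : Type} [Fintype n] [DecidableEq n]
    {L : Op n →ₗ[ℂ] Op n} (hL : IsCPTP L) (hinj : Function.Injective L) :
    ∃ W : Op n, W.IsHermitian ∧ IsUnit (L W) := by
  obtain ⟨W, hW⟩ := (LinearMap.injective_iff_surjective.1 hinj) 1
  refine ⟨W, hinj ?_, by rw [hW]; exact isUnit_one⟩
  rw [hL.1.map_conjTranspose, hW, conjTranspose_one]

theorem IsInvertibleEvolution.injective {d : ℕ} {Λ : ℝ → Op (Fin d) →ₗ[ℂ] Op (Fin d)}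
    (h : IsInvertibleEvolution Λ) {t : ℝ} (ht : 0 ≤ t) : Function.Injective (Λ t) := by
  obtain ⟨L, hL⟩ := h t ht
  exact Function.LeftInverse.injective (g := L) fun X => LinearMap.congr_fun hL X

theorem theorem2 (d : ℕ) (Λ : ℝ → Op (Fin d) →ₗ[ℂ] Op (Fin d))
    (hΛ : IsEvolution Λ) (hnM : ¬ IsMarkovian Λ)
    (h : IsInvertibleEvolution Λ ∨ d = 2) :
    ∃ (dB dC : ℕ) (ρ : Op (Fin d × (Fin dB × Fin dC))), IsState ρ ∧
      ∃ t : ℝ, 0 < t ∧ ∃ r : ℝ, 0 < r ∧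
        HasDerivAt
          (fun τ : ℝ => negativityABC (ampliation (Fin dB × Fin dC) (Λ τ) ρ)) r t := by
  by_contra hcon
  apply hnM
  have hN : HasNoTraceNormIncrease Λ := by
    refine hasNoTraceNormIncrease_of_negativity hΛ fun dB dC ρ hρ t ht r hr => ?_
    by_contra hr0
    exact hcon ⟨dB, dC, ρ, hρ, t, ht, r, not_le.1 hr0, hr⟩
  rcases h with hinv | rfl
  · have hmono := hN.antitoneOn hΛ fun t ht => Or.inl
      (exists_isHermitian_isUnit_of_injective (hΛ.cptp t ht.le) (hinv.injective ht.le))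
    exact fun s t hs hst => exists_isCPTP_comp_of_injective hΛ hmono hs hst (hinv.injective hs)
  · have hmono := hN.antitoneOn hΛ fun t ht => by
      by_cases hW : ∃ W : Op (Fin 2), W.IsHermitian ∧ IsUnit (Λ t W)
      · exact Or.inl hW
      · push Not at hW
        exact Or.inr ((hΛ.cptp t ht.le).eq_trace_smul_of_forall_not_isUnit hW)
    intro s t hs hst
    by_cases hinj : Function.Injective (Λ s)
    · exact exists_isCPTP_comp_of_injective hΛ hmono hs hst hinj
    · have hctr : ∀ X : Op (Fin 2), X.IsHermitian → traceNorm (Λ t X) ≤ traceNorm (Λ s X) :=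
        fun X hX => antitoneOn_traceNorm_apply hmono hX hs (hs.trans hst) hst
      exact exists_isCPTP_comp_of_finrank_le_two (hΛ.cptp s hs) (hΛ.cptp t (hs.trans hst))
        (ker_le_ker_of_traceNorm_le (hΛ.cptp s hs) hctr) hctr
        (finrank_range_le_two hΛ hmono hs hinj)
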